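/- **Setting.** Write points of $\mathbb{R}^{1+2}$ as $(t,x)$, $x=(x^1,x^2)$, $r=|x|$, $\langle\rho\rangle=(1+\rho^2)^{1/2}$. Fix a smooth cut-off $\chi:\mathbb{R}\to\mathbb{R}$ with $\chi=0$ on $(-\infty,0]$, $\chi=1$ on $[1,\infty)$, and, on $(0,1)$, $\chi'>0$ and $|\chi'|+|\chi''|\le K\chi^{1/2}$ for some constant $K$. For $s\ge 2$ put $\rho_H(s)=(s^2-1)/2$, $\xi(s,r)=1-\chi(r-\rho_H(s))$ and $$T(s,r)=s+\int_0^r\frac{\xi(s,\rho)\,\rho}{(s^2+\rho^2)^{1/2}}\,d\rho .$$ The transition part and the flat part of the slice $\{t=T(s,|x|)\}$ are $$\mathcal T_s=\{(T(s,r),x):\rho_H(s)\le r\le\rho_H(s)+1\},\qquad \mathcal P_s=\{(T(s,r),x): r\ge\rho_H(s)+1\};$$ put $\mathcal{TP}_s=\mathcal T_s\cup\mathcal P_s$ and $\mathcal{TP}_{[s_0,s_1]}=\bigcup_{s_0\le s\le s_1}\mathcal{TP}_s$. Let $\aleph:\mathbb{R}\to\mathbb{R}$ be nondecreasing with $\aleph(y)=0$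 for $y\le0$ and $\aleph(y)=y+1$ for $y\ge1$, and put $\omega(t,r)=1+\aleph(2+r-t)$. For $\alpha\in\{0,1,2\}$ and $a\in\{1,2\}$ let $\partial_0=\partial_t$, $\partial_a=\partial_{x^a}$, $L_a=x^a\partial_t+t\partial_a$, $\Omega=x^1\partial_2-x^2\partial_1$, and $$\tilde\partial_a=\frac{x^a}{r}\partial_t+\partial_a,\qquad \bar\partial_a=\frac{\xi(s,r)x^a}{(s^2+r^2)^{1/2}}\partial_t+\partial_a,\qquad \zeta=\Big(1-\frac{\xi(s,r)^2r^2}{s^2+r^2}\Big)^{1/2}.$$ Define the weighted energy $$E_\eta^{\mathcal{TP}}(s,u)=\int_{\{|x|\ge\rho_H(s)\}}\omega^{2\eta}\Big(|\zeta\,\partial_tu|^2+\sum_{a=1,2}|\bar\partial_au|^2\Big)\Big|_{t=T(s,|x|)}\,dx\in[0,\infty],$$ and $E_\eta^{\mathcal{TP},3}(s,u)=\sum_ZE_\eta^{\mathcal{TP}}(s,Zu)$, the sum being over all compositions $Z$ of at most three of the vector fields $\partial_0,\partial_1,\partial_2,L_1,L_2,\Omega$ (including $Z=\mathrm{id}$).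 **Proposition.** There is a constant $C>0$, depending only on $\chi$, such that the following holds for all $2\le s_0\le s_1$ and all $\eta\in(0,1)$. Let $u$ be a real function of class $C^4$ on an open neighbourhood of $\mathcal{TP}_{[s_0,s_1]}$. Then for every $s\in[s_0,s_1]$, every $(t,x)\in\mathcal{TP}_s$, all $\alpha\in\{0,1,2\}$ and all $a\in\{1,2\}$, $$\langle r\rangle^{1/2}\,\omega^{\eta}\,|\partial_\alpha u(t,x)|+\langle r\rangle^{1/2+\eta}\,|\tilde\partial_au(t,x)|\le C\,(1-\eta)^{-1}\,E_\eta^{\mathcal{TP},3}(s,u)^{1/2}.$$ No decay of $u$ at spatial infinity is required beyond the finiteness of the right-hand side (the inequality is trivial when $E_\eta^{\mathcal{TP},3}(s,u)=\infty$). -/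

import Mathlib

open Set MeasureTheory
open scoped ENNReal ContDiff

noncomputable section

namespace EuclHyp

/-- The plane with its Euclidean norm and Lebesgue measure. -/
abbrev Plane : Type := EuclideanSpace ℝ (Fin 2)

/-- Points `(t, x)` of `ℝ^{1+2}`. -/
abbrev Spacetime : Type := ℝ × Plane

/-! ### The cut-off function, the weight profile, and the foliation -/

/-- The cut-off functions from which the foliation is built: smooth, `0` on `(-∞, 0]`, `1` on
`[1, ∞)`, and on `(0, 1)` with positive derivative and `|χ'| + |χ''| ≲ χ^{1/2}`. -/
structure IsCutoff (χ : ℝ → ℝ) : Prop where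
  smooth : ContDiff ℝ ∞ χ
  eq_one : ∀ x, 1 ≤ x → χ x = 1
  eq_zero : ∀ x, x ≤ 0 → χ x = 0
  deriv_pos : ∀ x ∈ Ioo (0 : ℝ) 1, 0 < deriv χ x
  deriv_bound : ∃ K : ℝ, ∀ x ∈ Ioo (0 : ℝ) 1,
    |deriv χ x| + |deriv (deriv χ) x| ≤ K * Real.sqrt (χ x)

/-- The profile of the weight: nondecreasing, `0` on `(-∞, 0]` and `r + 1` on `[1, ∞)`.
(Under the additional bound `ℵ' ≤ 2` it would have to be `2 r` on `[0, 1]`; no upper bound on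
the slope is imposed.) -/
structure IsWeightProfile (aleph : ℝ → ℝ) : Prop where
  eq_zero : ∀ r, r ≤ 0 → aleph r = 0
  eq_add_one : ∀ r, 1 ≤ r → aleph r = r + 1
  mono : Monotone aleph

/-- The Japanese bracket `⟨ρ⟩ = (1 + ρ²)^{1/2}`. -/
def bracket (ρ : ℝ) : ℝ := Real.sqrt (1 + ρ ^ 2)

/-- `ρ_H(s) = (s² - 1)/2`. -/
def rhoH (s : ℝ) : ℝ := (s ^ 2 - 1) / 2

/-- `ξ(s, r) = 1 - χ(r - ρ_H(s))`. -/
def xi (χ : ℝ → ℝ) (s r : ℝ) : ℝ := 1 - χ (r - rhoH s)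

/-- The slope `ξ(s, r) r / (s² + r²)^{1/2}` of the slice of parameter `s`. -/
def slope (χ : ℝ → ℝ) (s r : ℝ) : ℝ := xi χ s r * r / Real.sqrt (s ^ 2 + r ^ 2)

/-- The time function: the solution of `∂_r T = ξ(s, r) r / (s² + r²)^{1/2}`, `T(s, 0) = s`. -/
def timeFn (χ : ℝ → ℝ) (s r : ℝ) : ℝ := s + ∫ ρ in (0 : ℝ)..r, slope χ s ρ

/-- The point of the slice `{t = T(s, |x|)}` above `x`. -/
def slicePoint (χ : ℝ → ℝ) (s : ℝ) (x : Plane) : Spacetime := (timeFn χ s ‖x‖, x)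

/-- The annulus below the transition part of the slice of parameter `s`. -/
def transBase (s : ℝ) : Set Plane := {x | rhoH s ≤ ‖x‖ ∧ ‖x‖ ≤ rhoH s + 1}

/-- The exterior of the disc below the flat part of the slice of parameter `s`. -/
def flatBase (s : ℝ) : Set Plane := {x | rhoH s + 1 ≤ ‖x‖}

/-- The transition part of the slice of parameter `s`. -/
def transSlice (χ : ℝ → ℝ) (s : ℝ) : Set Spacetime := slicePoint χ s '' transBase s

/-- The flat part of the slice of parameter `s`. -/
def flatSlice (χ : ℝ → ℝ) (s : ℝ) : Set Spacetime := slicePoint χ s '' flatBase s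

/-- The exterior (transition and flat) part of the slice of parameter `s`. -/
def tpSlice (χ : ℝ → ℝ) (s : ℝ) : Set Spacetime := transSlice χ s ∪ flatSlice χ s

/-- The transition-flat region between the slices of parameters `s₀` and `s₁`. -/
def tpRegion (χ : ℝ → ℝ) (s₀ s₁ : ℝ) : Set Spacetime := ⋃ s ∈ Icc s₀ s₁, tpSlice χ s

/-- The weight `ω(t, r) = 1 + ℵ(2 + r - t)`. -/
def weight (aleph : ℝ → ℝ) (t r : ℝ) : ℝ := 1 + aleph (2 + r - t)

/-! ### Vector fields -/

/-- `∂_t u`. -/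
def dt (u : Spacetime → ℝ) (p : Spacetime) : ℝ := fderiv ℝ u p (1, 0)

/-- `∂_a u`, with `a = 0, 1` standing for the two space directions. -/
def dx (a : Fin 2) (u : Spacetime → ℝ) (p : Spacetime) : ℝ :=
  fderiv ℝ u p (0, EuclideanSpace.single a 1)

/-- `∂_α u`, with `α = 0` the time direction. -/
def pd (α : Fin 3) (u : Spacetime → ℝ) : Spacetime → ℝ :=
  Fin.cases (dt u) (fun a => dx a u) α

/-- The Lorentzian boost `L_a = x^a ∂_t + t ∂_a`. -/
def boost (a : Fin 2) (u : Spacetime → ℝ) (p : Spacetime) : ℝ :=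
  p.2 a * dt u p + p.1 * dx a u p

/-- The rotation `Ω = x^1 ∂_2 - x^2 ∂_1`. -/
def rot (u : Spacetime → ℝ) (p : Spacetime) : ℝ :=
  p.2 0 * dx 1 u p - p.2 1 * dx 0 u p

/-- The semi-null derivative `(x^a / r) ∂_t + ∂_a`. -/
def nullD (a : Fin 2) (u : Spacetime → ℝ) (p : Spacetime) : ℝ :=
  p.2 a / ‖p.2‖ * dt u p + dx a u p

/-- The derivative `ξ(s, r) x^a / (s² + r²)^{1/2} ∂_t + ∂_a`, tangent to the slice of
parameter `s` at the points of that slice. -/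
def tangD (χ : ℝ → ℝ) (s : ℝ) (a : Fin 2) (u : Spacetime → ℝ) (p : Spacetime) : ℝ :=
  xi χ s ‖p.2‖ * p.2 a / Real.sqrt (s ^ 2 + ‖p.2‖ ^ 2) * dt u p + dx a u p

/-- Labels of the vector fields `∂_α` (left), and `L_a`, `Ω` (right). -/
abbrev Field : Type := Fin 3 ⊕ (Fin 2 ⊕ Unit)

/-- The action of a single vector field. -/
def Field.act : Field → (Spacetime → ℝ) → Spacetime → ℝ
  | .inl α => pd α
  | .inr (.inl a) => boost a
  | .inr (.inr _) => rot

/-- The action of the composition `Z_0 Z_1 ⋯ Z_{n-1}`. -/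
def compose {n : ℕ} (Z : Fin n → Field) (u : Spacetime → ℝ) : Spacetime → ℝ :=
  (List.ofFn Z).foldr Field.act u

/-- The number of boosts and rotations in a composition. -/
def rank {n : ℕ} (Z : Fin n → Field) : ℕ :=
  (Finset.univ.filter fun i => (Z i).isRight = true).card

/-! ### Energies -/

/-- `ζ = (1 - ξ² r² / (s² + r²))^{1/2}`. -/
def zeta (χ : ℝ → ℝ) (s r : ℝ) : ℝ :=
  Real.sqrt (1 - xi χ s r ^ 2 * r ^ 2 / (s ^ 2 + r ^ 2))

/-- The energy density on the slice of parameter `s`. -/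
def density (χ : ℝ → ℝ) (s : ℝ) (u : Spacetime → ℝ) (p : Spacetime) : ℝ :=
  (zeta χ s ‖p.2‖ * dt u p) ^ 2 + ∑ a : Fin 2, (tangD χ s a u p) ^ 2

/-- The energy with weight `ω^{2η}` on the part of the slice of parameter `s` above `B`. -/
def energyOn (χ aleph : ℝ → ℝ) (B : Set Plane) (η s : ℝ) (u : Spacetime → ℝ) : ℝ≥0∞ :=
  ∫⁻ x in B, ENNReal.ofReal
    (weight aleph (timeFn χ s ‖x‖) ‖x‖ ^ (2 * η) * density χ s u (slicePoint χ s x))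

/-- The weighted energy on the transition-flat part of the slice of parameter `s`. -/
def energyTP (χ aleph : ℝ → ℝ) (η s : ℝ) (u : Spacetime → ℝ) : ℝ≥0∞ :=
  energyOn χ aleph (transBase s) η s u + energyOn χ aleph (flatBase s) η s u

/-- The weighted energy of order `p` and rank `k` on the transition-flat part: the sum of the
energies of `Z u` over all compositions `Z` of at most `p` vector fields, at most `k` of which
are boosts or rotations. -/
def energyTPOrd (χ aleph : ℝ → ℝ) (p k : ℕ) (η s : ℝ) (u : Spacetime → ℝ) : ℝ≥0∞ :=
  ∑ n ∈ Finset.range (p + 1), ∑ Z : Fin n → Field,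
    if rank Z ≤ k then energyTP χ aleph η s (compose Z u) else 0

end EuclHyp

end

namespace EuclHyp

/-! Write `R` for `rhoH s`, `T` for the time function on the slice and `w` for the weight. On the
exterior part `T` stays in `[R + 1, R + 2]`, so `w = 4 + r - T` there; it is at least 3,
nondecreasing in `r`, and at least `r - R + 2`.

Bounds for `∂W`: apply a one-dimensional Sobolev inequality in the angle and then in the radius on
`[r, r + 2]`. The difficulty is the factor `ζ`, which degenerates on the transition annulus. It is
avoided by taking the undifferentiated `L²` norm only over `[r + 1, r + 2]`, which lies in the flat
part, where the density controls the full gradient. Over all of `[r, r + 2]` only the derivative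
along the slice enters, and the density controls it without loss. The factor `r w ^ (2 η)`, monotone
in `r`, is pulled out at the inner radius. This is `ofReal_pd_sq_le`; it costs two further vector
fields, so it applies to `W = u` and `W = L_a u`.

Semi-null derivatives: `nullD` equals `L_a u / t` plus a term with the factor `(t - r) / t`, and `|t
- r|` is bounded by a multiple of `w`. For `r ≥ 2 R + 2` the weight is comparable to `r` and the
gradient bound suffices. For smaller `r`, `L_a u` is integrated inward along a ray from `r = 2 R +
2`, where it is bounded through `∂u`. Its derivative is of size `R ^ (-1/2) (r - R + 2) ^ (-η)`,
whose integral yields `R ^ (1/2 - η) (1 - η)⁻¹`. Starting at a finite radius makes any assumption of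
decay at infinity unnecessary. -/

/-! ### One-dimensional Sobolev inequality. -/

theorem sq_le_sobolev {f f' : ℝ → ℝ} {a b c d x : ℝ} (hac : a ≤ c) (hcd : c + 1 ≤ d) (hdb : d ≤ b)
    (hf : ∀ y ∈ Icc a b, HasDerivAt f (f' y) y) (hf' : ContinuousOn f' (Icc a b))
    (hx : x ∈ Icc a b) :
    f x ^ 2 ≤ 2 * (∫ y in c..d, f y ^ 2) + 2 * (b - a) * ∫ y in a..b, f' y ^ 2 := by
  have hab : a ≤ b := by linarith
  have hcd' : c ≤ d := by linarith
  have hfc : ContinuousOn f (Icc a b) := fun y hy => (hf y hy).continuousAt.continuousWithinAt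
  have hsub : Icc c d ⊆ Icc a b := Icc_subset_Icc hac hdb
  -- Since `[c, d]` has length at least 1, the minimum of `f²` there is at most its integral.
  obtain ⟨y, hy, hmin⟩ := isCompact_Icc.exists_isMinOn (nonempty_Icc.2 hcd')
    ((hfc.mono hsub).pow 2)
  have hi1 : IntervalIntegrable (fun y => f y ^ 2) volume c d :=
    ContinuousOn.intervalIntegrable (by rw [uIcc_of_le hcd']; exact (hfc.mono hsub).pow 2)
  have hi2 : IntervalIntegrable (fun y => f' y ^ 2) volume a b :=
    ContinuousOn.intervalIntegrable (by rw [uIcc_of_le hab]; exact hf'.pow 2)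
  have h0 : 0 ≤ f y ^ 2 := sq_nonneg _
  have h1 : f y ^ 2 ≤ ∫ y in c..d, f y ^ 2 := by
    have := intervalIntegral.integral_mono_on hcd'
      (_root_.intervalIntegrable_const (c := f y ^ 2) (μ := volume)) hi1
      (fun z hz => hmin hz)
    rw [intervalIntegral.integral_const, smul_eq_mul] at this
    nlinarith
  have key : ∀ p ∈ Icc a b, ∀ q ∈ Icc a b, p ≤ q →
      (f q - f p) ^ 2 ≤ (b - a) * ∫ y in a..b, f' y ^ 2 := by
    intro p hp q hq hpq
    have hs : Icc p q ⊆ Icc a b := Icc_subset_Icc hp.1 hq.2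
    have hip : IntervalIntegrable f' volume p q :=
      ContinuousOn.intervalIntegrable (by rw [uIcc_of_le hpq]; exact hf'.mono hs)
    have hip2 : IntervalIntegrable (fun y => f' y ^ 2) volume p q :=
      ContinuousOn.intervalIntegrable (by rw [uIcc_of_le hpq]; exact (hf'.mono hs).pow 2)
    have e1 : ∫ y in p..q, f' y = f q - f p :=
      intervalIntegral.integral_eq_sub_of_hasDerivAt
        (fun z hz => hf z (hs (by rwa [uIcc_of_le hpq] at hz))) hip
    set m := f q - f p with hm
    set J := ∫ y in p..q, f' y ^ 2 with hJ
    have hJ0 : 0 ≤ J := intervalIntegral.integral_nonneg hpq (fun _ _ => sq_nonneg _)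
    have hJJ : J ≤ ∫ y in a..b, f' y ^ 2 :=
      intervalIntegral.integral_mono_interval hp.1 hpq hq.2
        (Filter.Eventually.of_forall fun _ => sq_nonneg _) hi2
    -- Cauchy–Schwarz through the nonnegative quadratic `∫ (f' - k)²`, used below at its minimiser
    -- `k = m / (q - p)`.
    have e2 : ∀ k : ℝ, 0 ≤ J - 2 * k * m + k ^ 2 * (q - p) := by
      intro k
      have : 0 ≤ ∫ y in p..q, (f' y - k) ^ 2 :=
        intervalIntegral.integral_nonneg hpq (fun _ _ => sq_nonneg _)
      have e3 : ∫ y in p..q, (f' y - k) ^ 2 = J - 2 * k * m + k ^ 2 * (q - p) := by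
        have : ∀ y, (f' y - k) ^ 2 = (f' y ^ 2 - (2 * k) * f' y) + k ^ 2 := fun y => by ring
        simp_rw [this]
        rw [intervalIntegral.integral_add (hip2.sub (hip.const_mul _)) (by simp),
          intervalIntegral.integral_sub hip2 (hip.const_mul _),
          intervalIntegral.integral_const_mul, e1, intervalIntegral.integral_const, smul_eq_mul]
        ring
      linarith
    have e4 : m ^ 2 ≤ (q - p) * J := by
      rcases eq_or_lt_of_le hpq with h | h
      · have : m = 0 := by rw [hm, h]; ring
        rw [this, h]; simp
      · have h5 := e2 (m / (q - p))
        have h6 : 0 < q - p := by linarith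
        have h7 : J - 2 * (m / (q - p)) * m + (m / (q - p)) ^ 2 * (q - p) = J - m ^ 2 / (q - p) := by
          field_simp; ring
        rw [h7] at h5
        have h8 : m ^ 2 / (q - p) ≤ J := by linarith
        rw [div_le_iff₀ h6] at h8
        linarith
    calc m ^ 2 ≤ (q - p) * J := e4
      _ ≤ (b - a) * ∫ y in a..b, f' y ^ 2 := by
        apply mul_le_mul _ hJJ hJ0 (by linarith)
        linarith [hp.1, hq.2]
  have h2 : (f x - f y) ^ 2 ≤ (b - a) * ∫ y in a..b, f' y ^ 2 := by
    rcases le_total x y with h | h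
    · have := key x hx y (hsub hy) h
      nlinarith
    · exact key y (hsub hy) x hx h
  -- The identity `2 B² + 2 (A - B)² - A² = (A - 2 B)²`, with `A = f x` and `B = f y`.
  nlinarith [sq_nonneg (f x - 2 * f y)]

theorem ofReal_integral_sq_eq {f : ℝ → ℝ} {a b : ℝ} (hab : a ≤ b) (hf : ContinuousOn f (Icc a b)) :
    ENNReal.ofReal (∫ y in a..b, f y ^ 2) = ∫⁻ y in Ioo a b, ENNReal.ofReal (f y ^ 2) := by
  have hi : IntegrableOn (fun y => f y ^ 2) (Icc a b) := (hf.pow 2).integrableOn_Icc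
  rw [intervalIntegral.integral_of_le hab, ← integral_Ioc_eq_integral_Ioo.symm,
    ofReal_integral_eq_lintegral_ofReal (hi.mono_set Ioo_subset_Icc_self)
      (Filter.Eventually.of_forall fun _ => sq_nonneg _)]

theorem ofReal_sq_le_sobolev {f f' : ℝ → ℝ} {a b c d x : ℝ} (hac : a ≤ c) (hcd : c + 1 ≤ d)
    (hdb : d ≤ b)
    (hf : ∀ y ∈ Icc a b, HasDerivAt f (f' y) y) (hf' : ContinuousOn f' (Icc a b))
    (hx : x ∈ Icc a b) :
    ENNReal.ofReal (f x ^ 2) ≤ 2 * (∫⁻ y in Ioo c d, ENNReal.ofReal (f y ^ 2)) +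
      ENNReal.ofReal (2 * (b - a)) * ∫⁻ y in Ioo a b, ENNReal.ofReal (f' y ^ 2) := by
  have hab : a ≤ b := by linarith
  have hcd' : c ≤ d := by linarith
  have hfc : ContinuousOn f (Icc a b) := fun y hy => (hf y hy).continuousAt.continuousWithinAt
  rw [← ofReal_integral_sq_eq hcd' (hfc.mono (Icc_subset_Icc hac hdb)),
    ← ofReal_integral_sq_eq hab hf', ← ENNReal.ofReal_mul (by linarith),
    show (2 : ℝ≥0∞) = ENNReal.ofReal 2 by simp, ← ENNReal.ofReal_mul (by norm_num),
    ← ENNReal.ofReal_add]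
  · exact ENNReal.ofReal_le_ofReal (sq_le_sobolev hac hcd hdb hf hf' hx)
  · exact mul_nonneg (by norm_num) (intervalIntegral.integral_nonneg hcd' fun _ _ => sq_nonneg _)
  · exact mul_nonneg (by linarith) (intervalIntegral.integral_nonneg hab fun _ _ => sq_nonneg _)

/-! ### Geometry of the slices and of the weight. -/

theorem IsCutoff.mem_Icc {χ : ℝ → ℝ} (hχ : IsCutoff χ) (x : ℝ) : χ x ∈ Icc (0 : ℝ) 1 := by
  rcases le_total x 0 with h | h
  · simp [hχ.eq_zero x h]
  rcases le_total 1 x with h' | h'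
  · simp [hχ.eq_one x h']
  have hm : MonotoneOn χ (Icc 0 1) := by
    apply monotoneOn_of_deriv_nonneg (convex_Icc 0 1) hχ.smooth.continuous.continuousOn
    · exact (hχ.smooth.differentiable (by simp)).differentiableOn
    · intro y hy
      rw [interior_Icc] at hy
      exact (hχ.deriv_pos y hy).le
  have h0 := hm (left_mem_Icc.2 zero_le_one) ⟨h, h'⟩ h
  have h1 := hm ⟨h, h'⟩ (right_mem_Icc.2 zero_le_one) h'
  rw [hχ.eq_zero 0 le_rfl] at h0
  rw [hχ.eq_one 1 le_rfl] at h1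
  exact ⟨h0, h1⟩

theorem xi_mem_Icc {χ : ℝ → ℝ} (hχ : IsCutoff χ) (s r : ℝ) : xi χ s r ∈ Icc (0 : ℝ) 1 := by
  have := hχ.mem_Icc (r - rhoH s)
  exact ⟨by unfold xi; linarith [this.2], by unfold xi; linarith [this.1]⟩

theorem xi_eq_zero {χ : ℝ → ℝ} (hχ : IsCutoff χ) {s r : ℝ} (h : rhoH s + 1 ≤ r) :
    xi χ s r = 0 := by
  unfold xi; rw [hχ.eq_one _ (by linarith)]; ring

theorem xi_eq_one {χ : ℝ → ℝ} (hχ : IsCutoff χ) {s r : ℝ} (h : r ≤ rhoH s) :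
    xi χ s r = 1 := by
  unfold xi; rw [hχ.eq_zero _ (by linarith)]; ring

theorem zeta_eq_one {χ : ℝ → ℝ} (hχ : IsCutoff χ) {s r : ℝ} (h : rhoH s + 1 ≤ r) :
    zeta χ s r = 1 := by
  simp [zeta, xi_eq_zero hχ h]

theorem continuous_xi {χ : ℝ → ℝ} (hχ : IsCutoff χ) (s : ℝ) : Continuous (xi χ s) := by
  have := hχ.smooth.continuous
  unfold xi; fun_prop

theorem sq_add_sq_pos {s : ℝ} (hs : 2 ≤ s) (r : ℝ) : 0 < s ^ 2 + r ^ 2 := by nlinarith [sq_nonneg r]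

theorem continuous_slope {χ : ℝ → ℝ} (hχ : IsCutoff χ) {s : ℝ} (hs : 2 ≤ s) :
    Continuous (slope χ s) := by
  have := continuous_xi hχ s
  unfold slope
  exact Continuous.div (by fun_prop) (by fun_prop)
    fun r => (Real.sqrt_pos.2 (sq_add_sq_pos hs r)).ne'

theorem hasDerivAt_timeFn {χ : ℝ → ℝ} (hχ : IsCutoff χ) {s : ℝ} (hs : 2 ≤ s) (r : ℝ) :
    HasDerivAt (timeFn χ s) (slope χ s r) r :=
  ((continuous_slope hχ hs).integral_hasStrictDerivAt 0 r).hasDerivAt.const_add s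

theorem slope_mem_Icc {χ : ℝ → ℝ} (hχ : IsCutoff χ) {s : ℝ} (hs : 2 ≤ s) {r : ℝ} (hr : 0 ≤ r) :
    slope χ s r ∈ Icc (0 : ℝ) 1 := by
  have hp := Real.sqrt_pos.2 (sq_add_sq_pos hs r)
  have hx := xi_mem_Icc hχ s r
  have hle : r ≤ Real.sqrt (s ^ 2 + r ^ 2) := Real.le_sqrt_of_sq_le (by nlinarith [sq_nonneg s])
  refine ⟨div_nonneg (mul_nonneg hx.1 hr) hp.le, ?_⟩
  unfold slope
  rw [div_le_one hp]
  nlinarith [hx.1, hx.2]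

theorem rhoH_ge {s : ℝ} (hs : 2 ≤ s) : 3 / 2 ≤ rhoH s := by unfold rhoH; nlinarith

/-- Up to `rhoH s` the slice is the hyperboloid `t² = s² + r²`, and `s² + rhoH² = (rhoH + 1)²`. -/
theorem timeFn_rhoH {χ : ℝ → ℝ} (hχ : IsCutoff χ) {s : ℝ} (hs : 2 ≤ s) :
    timeFn χ s (rhoH s) = rhoH s + 1 := by
  have h0 : (0 : ℝ) ≤ rhoH s := by linarith [rhoH_ge hs]
  have : ∫ ρ in (0 : ℝ)..rhoH s, slope χ s ρ =
      Real.sqrt (s ^ 2 + rhoH s ^ 2) - Real.sqrt (s ^ 2 + 0 ^ 2) := by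
    refine intervalIntegral.integral_eq_sub_of_hasDerivAt
      (f := fun ρ => Real.sqrt (s ^ 2 + ρ ^ 2)) (fun x hx => ?_)
      ((continuous_slope hχ hs).intervalIntegrable _ _)
    rw [uIcc_of_le h0] at hx
    have hd : HasDerivAt (fun ρ : ℝ => s ^ 2 + ρ ^ 2) (2 * x) x := by
      simpa using (hasDerivAt_pow 2 x).const_add (s ^ 2)
    refine (hd.sqrt (sq_add_sq_pos hs x).ne').congr_deriv (Eq.symm ?_)
    change xi χ s x * x / Real.sqrt (s ^ 2 + x ^ 2) = _
    rw [xi_eq_one hχ hx.2]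
    field_simp
  rw [timeFn, this, show s ^ 2 + rhoH s ^ 2 = (rhoH s + 1) ^ 2 by unfold rhoH; ring,
    Real.sqrt_sq (by linarith), zero_pow two_ne_zero, add_zero, Real.sqrt_sq (by linarith)]
  ring

theorem timeFn_sub_mem {χ : ℝ → ℝ} (hχ : IsCutoff χ) {s : ℝ} (hs : 2 ≤ s) {p q : ℝ}
    (hp : 0 ≤ p) (hpq : p ≤ q) : timeFn χ s q - timeFn χ s p ∈ Icc 0 (q - p) := by
  have hd : ∀ x, HasDerivAt (timeFn χ s) (slope χ s x) x := hasDerivAt_timeFn hχ hs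
  have hdf : Differentiable ℝ (timeFn χ s) := fun x => (hd x).differentiableAt
  have hS : ∀ x ∈ interior (Ici (0 : ℝ)), deriv (timeFn χ s) x ∈ Icc (0 : ℝ) 1 := fun x hx => by
    rw [(hd x).deriv]
    exact slope_mem_Icc hχ hs (interior_subset hx)
  constructor
  · have := (convex_Ici (0 : ℝ)).mul_sub_le_image_sub_of_le_deriv hdf.continuous.continuousOn
      hdf.differentiableOn (fun x hx => (hS x hx).1) p hp q (hp.trans hpq) hpq
    simpa using this
  · have := (convex_Ici (0 : ℝ)).image_sub_le_mul_sub_of_deriv_le hdf.continuous.continuousOn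
      hdf.differentiableOn (fun x hx => (hS x hx).2) p hp q (hp.trans hpq) hpq
    simpa using this

/-- The slope lies in `[0, 1]`, so the time grows by at most 1 across the transition annulus of
width 1; beyond it the slope vanishes. -/
theorem timeFn_mem_Icc {χ : ℝ → ℝ} (hχ : IsCutoff χ) {s : ℝ} (hs : 2 ≤ s) {r : ℝ}
    (hr : rhoH s ≤ r) : timeFn χ s r ∈ Icc (rhoH s + 1) (rhoH s + 2) := by
  have h0 := rhoH_ge hs
  have h1 := timeFn_sub_mem hχ hs (by linarith) hr
  rw [timeFn_rhoH hχ hs] at h1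
  refine ⟨by linarith [h1.1], ?_⟩
  have key : ∀ q, rhoH s + 1 ≤ q → timeFn χ s q ≤ timeFn χ s (rhoH s + 1) := by
    intro q hq
    have : ∫ ρ in (rhoH s + 1)..q, slope χ s ρ = 0 := by
      rw [intervalIntegral.integral_congr (g := fun _ => 0)]
      · simp
      · intro x hx
        rw [uIcc_of_le hq] at hx
        simp [slope, xi_eq_zero hχ hx.1]
    have h2 := intervalIntegral.integral_add_adjacent_intervals (a := 0) (b := rhoH s + 1) (c := q)
      (μ := volume)
      ((continuous_slope hχ hs).intervalIntegrable _ _)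
      ((continuous_slope hχ hs).intervalIntegrable _ _)
    unfold timeFn
    rw [← h2, this]; simp
  have h3 := timeFn_sub_mem hχ hs (p := rhoH s) (q := rhoH s + 1) (by linarith) (by linarith)
  rw [timeFn_rhoH hχ hs] at h3
  rcases le_total r (rhoH s + 1) with h | h
  · linarith [h1.2]
  · linarith [h3.2, key r h]

/-- On the exterior part of a slice the weight is `4 + r - t`. -/
theorem weight_eq {χ aleph : ℝ → ℝ} (hχ : IsCutoff χ) (ha : IsWeightProfile aleph) {s : ℝ}
    (hs : 2 ≤ s) {r : ℝ} (hr : rhoH s ≤ r) :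
    weight aleph (timeFn χ s r) r = 4 + r - timeFn χ s r := by
  have h0 := rhoH_ge hs
  have h1 := timeFn_sub_mem hχ hs (by linarith) hr
  rw [timeFn_rhoH hχ hs] at h1
  -- Since `T ≤ r + 1`, the argument `2 + r - T` is at least 1, so only the affine branch of the
  -- profile is met and no constant depends on `aleph`.
  rw [weight, ha.eq_add_one _ (by linarith [h1.2])]
  ring

theorem three_le_weight {χ aleph : ℝ → ℝ} (hχ : IsCutoff χ) (ha : IsWeightProfile aleph) {s : ℝ}
    (hs : 2 ≤ s) {r : ℝ} (hr : rhoH s ≤ r) : 3 ≤ weight aleph (timeFn χ s r) r := by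
  have h0 := rhoH_ge hs
  have h1 := timeFn_sub_mem hχ hs (by linarith) hr
  rw [timeFn_rhoH hχ hs] at h1
  rw [weight_eq hχ ha hs hr]
  linarith [h1.2]

theorem weight_mono {χ aleph : ℝ → ℝ} (hχ : IsCutoff χ) (ha : IsWeightProfile aleph) {s : ℝ}
    (hs : 2 ≤ s) {p q : ℝ} (hp : rhoH s ≤ p) (hpq : p ≤ q) :
    weight aleph (timeFn χ s p) p ≤ weight aleph (timeFn χ s q) q := by
  have h1 := timeFn_sub_mem hχ hs (by linarith [rhoH_ge hs]) hpq
  rw [weight_eq hχ ha hs hp, weight_eq hχ ha hs (hp.trans hpq)]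
  linarith [h1.2]

/-! ### Polar coordinates on a slice. -/

/-- Polar parametrization of a slice. -/
noncomputable def polarPoint (χ : ℝ → ℝ) (s : ℝ) (y : ℝ × ℝ) : Spacetime :=
  (timeFn χ s y.1, !₂[y.1 * Real.cos y.2, y.1 * Real.sin y.2])

@[simp] theorem norm_polarPoint (χ : ℝ → ℝ) (s : ℝ) (y : ℝ × ℝ) :
    ‖(polarPoint χ s y).2‖ = |y.1| := by
  rw [EuclideanSpace.norm_eq, ← Real.sqrt_sq_eq_abs]
  congr 1
  simp [polarPoint, mul_pow, ← mul_add]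

theorem slicePoint_polar (χ : ℝ → ℝ) (s : ℝ) {y : ℝ × ℝ} (hy : 0 ≤ y.1) :
    slicePoint χ s !₂[y.1 * Real.cos y.2, y.1 * Real.sin y.2] = polarPoint χ s y := by
  have := norm_polarPoint χ s y
  rw [abs_of_nonneg hy] at this
  change ‖(!₂[y.1 * Real.cos y.2, y.1 * Real.sin y.2] : Plane)‖ = _ at this
  rw [slicePoint, this, polarPoint]

theorem base_union (s : ℝ) : transBase s ∪ flatBase s = {x : Plane | rhoH s ≤ ‖x‖} := by
  ext x
  simp only [transBase, flatBase, mem_union, mem_ofPred_eq]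
  constructor
  · rintro (h | h) <;> linarith
  · intro h
    rcases le_total ‖x‖ (rhoH s + 1) with h' | h'
    · exact Or.inl ⟨h, h'⟩
    · exact Or.inr h'

theorem tpSlice_eq (χ : ℝ → ℝ) (s : ℝ) :
    tpSlice χ s = slicePoint χ s '' {x | rhoH s ≤ ‖x‖} := by
  rw [tpSlice, transSlice, flatSlice, ← image_union, base_union]

theorem polarPoint_mem {χ : ℝ → ℝ} {s : ℝ} (hs : 2 ≤ s) {y : ℝ × ℝ} (hy : rhoH s ≤ y.1) :
    polarPoint χ s y ∈ tpSlice χ s := by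
  have h0 : 0 ≤ y.1 := by linarith [rhoH_ge hs]
  have := norm_polarPoint χ s y
  rw [abs_of_nonneg h0] at this
  rw [tpSlice_eq, ← slicePoint_polar χ s h0]
  refine mem_image_of_mem _ ?_
  change rhoH s ≤ ‖(polarPoint χ s y).2‖
  rw [this]; exact hy

theorem exists_polarPoint {χ : ℝ → ℝ} {s : ℝ} {p : Spacetime} (hp : p ∈ tpSlice χ s) :
    ∃ y : ℝ × ℝ, rhoH s ≤ y.1 ∧ y.2 ∈ Icc (-Real.pi) Real.pi ∧ polarPoint χ s y = p := by
  rw [tpSlice_eq] at hp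
  obtain ⟨x, hx, rfl⟩ := hp
  have hn : ‖(⟨x 0, x 1⟩ : ℂ)‖ = ‖x‖ := by
    rw [EuclideanSpace.norm_eq, Complex.norm_eq_sqrt_sq_add_sq]; simp
  -- The angle may equal `π`; this is harmless because the angular Sobolev inequality holds on the
  -- closed interval and needs no periodicity.
  refine ⟨(‖x‖, Complex.arg ⟨x 0, x 1⟩), hx,
    ⟨(Complex.neg_pi_lt_arg _).le, Complex.arg_le_pi _⟩, ?_⟩
  have h1 := Complex.norm_mul_cos_arg ⟨x 0, x 1⟩
  have h2 := Complex.norm_mul_sin_arg ⟨x 0, x 1⟩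
  rw [hn] at h1 h2
  simp only [polarPoint, slicePoint, h1, h2]
  congr 1
  ext i; fin_cases i <;> rfl

theorem continuous_polarPoint {χ : ℝ → ℝ} (hχ : IsCutoff χ) {s : ℝ} (hs : 2 ≤ s) :
    Continuous (polarPoint χ s) := by
  have : Continuous (timeFn χ s) :=
    continuous_iff_continuousAt.2 fun r => (hasDerivAt_timeFn hχ hs r).continuousAt
  unfold polarPoint
  refine Continuous.prodMk (by fun_prop) ?_
  refine (PiLp.continuous_toLp 2 _).comp ?_
  refine continuous_pi fun i => ?_
  fin_cases i
  · simp; fun_prop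
  · simp; fun_prop

theorem fderiv_apply_eq (v : Spacetime → ℝ) (p : Spacetime) (τ a b : ℝ) :
    fderiv ℝ v p (τ, !₂[a, b]) = τ * dt v p + a * dx 0 v p + b * dx 1 v p := by
  have : ((τ, !₂[a, b]) : Spacetime) = τ • ((1 : ℝ), (0 : Plane)) +
      a • ((0 : ℝ), (EuclideanSpace.single 0 1 : Plane)) +
      b • ((0 : ℝ), (EuclideanSpace.single 1 1 : Plane)) := by
    ext i
    · simp
    · fin_cases i <;> simp
  rw [this]
  simp only [map_add, map_smul, smul_eq_mul, dt, dx]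

theorem hasDerivAt_toLp {f g : ℝ → ℝ} {f' g' x : ℝ} (hf : HasDerivAt f f' x)
    (hg : HasDerivAt g g' x) :
    HasDerivAt (fun y => (!₂[f y, g y] : Plane)) !₂[f', g'] x := by
  have : HasDerivAt (fun y => ![f y, g y]) ![f', g'] x := by
    rw [hasDerivAt_pi]
    intro i; fin_cases i
    · simpa using hf
    · simpa using hg
  exact (PiLp.continuousLinearEquiv 2 ℝ (fun _ : Fin 2 => ℝ)).symm.hasFDerivAt.comp_hasDerivAt x this

theorem hasDerivAt_radial {χ : ℝ → ℝ} (hχ : IsCutoff χ) {s : ℝ} (hs : 2 ≤ s) {v : Spacetime → ℝ}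
    {r θ : ℝ} (hv : DifferentiableAt ℝ v (polarPoint χ s (r, θ))) :
    HasDerivAt (fun ρ => v (polarPoint χ s (ρ, θ)))
      (slope χ s r * dt v (polarPoint χ s (r, θ)) + Real.cos θ * dx 0 v (polarPoint χ s (r, θ)) +
        Real.sin θ * dx 1 v (polarPoint χ s (r, θ))) r := by
  have h : HasDerivAt (fun ρ => polarPoint χ s (ρ, θ))
      (slope χ s r, !₂[Real.cos θ, Real.sin θ]) r := by
    refine (hasDerivAt_timeFn hχ hs r).prodMk ?_
    refine hasDerivAt_toLp ?_ ?_
    · simpa using (hasDerivAt_id r).mul_const (Real.cos θ)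
    · simpa using (hasDerivAt_id r).mul_const (Real.sin θ)
  rw [← fderiv_apply_eq]
  exact hv.hasFDerivAt.comp_hasDerivAt r h

theorem hasDerivAt_angular {χ : ℝ → ℝ} {s : ℝ} {v : Spacetime → ℝ}
    {r θ : ℝ} (hv : DifferentiableAt ℝ v (polarPoint χ s (r, θ))) :
    HasDerivAt (fun φ => v (polarPoint χ s (r, φ))) (rot v (polarPoint χ s (r, θ))) θ := by
  have h : HasDerivAt (fun φ => polarPoint χ s (r, φ))
      (0, !₂[r * -Real.sin θ, r * Real.cos θ]) θ :=
    (hasDerivAt_const θ (timeFn χ s r)).prodMk (hasDerivAt_toLp ((Real.hasDerivAt_cos θ).const_mul r)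
      ((Real.hasDerivAt_sin θ).const_mul r))
  have := hv.hasFDerivAt.comp_hasDerivAt θ h
  rw [fderiv_apply_eq] at this
  refine this.congr_deriv ?_
  simp [rot, polarPoint]
  ring

/-! ### Regularity of the vector fields and commutation with the rotation. -/

theorem contDiffOn_fderiv_apply {U : Set Spacetime} (hU : IsOpen U) {W : Spacetime → ℝ}
    {m n : ℕ∞ω} (hW : ContDiffOn ℝ n W U) (hmn : m + 1 ≤ n) (e : Spacetime) :
    ContDiffOn ℝ m (fun p => fderiv ℝ W p e) U :=
  (hW.fderiv_of_isOpen hU hmn).clm_apply contDiffOn_const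

theorem contDiff_coord (i : Fin 2) {n : ℕ∞ω} : ContDiff ℝ n fun p : Spacetime => p.2 i :=
  ((EuclideanSpace.proj i : Plane →L[ℝ] ℝ).comp (ContinuousLinearMap.snd ℝ ℝ Plane)).contDiff

theorem contDiffOn_act {U : Set Spacetime} (hU : IsOpen U) {W : Spacetime → ℝ}
    {m n : ℕ∞ω} (hW : ContDiffOn ℝ n W U) (hmn : m + 1 ≤ n) (Z : Field) :
    ContDiffOn ℝ m (Z.act W) U := by
  have h := fun e => contDiffOn_fderiv_apply hU hW hmn e
  rcases Z with α | a | _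
  · exact Fin.cases (h _) (fun a => h _) α
  · exact ((contDiff_coord a).contDiffOn.mul (h _)).add (contDiff_fst.contDiffOn.mul (h _))
  · exact ((contDiff_coord 0).contDiffOn.mul (h _)).sub ((contDiff_coord 1).contDiffOn.mul (h _))

/-- Product rule plus symmetry of the second derivative: the commutator of a constant field with `Ω`
comes only from differentiating the coefficients of `Ω`. -/
theorem fderiv_rot_apply {U : Set Spacetime} (hU : IsOpen U) {W : Spacetime → ℝ}
    (hW : ContDiffOn ℝ 2 W U) {p : Spacetime} (hp : p ∈ U) (e : Spacetime) :
    fderiv ℝ (rot W) p e = e.2 0 * dx 1 W p - e.2 1 * dx 0 W p +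
      rot (fun q => fderiv ℝ W q e) p := by
  have hn := hU.mem_nhds hp
  have hsymm : IsSymmSndFDerivAt ℝ W p :=
    (hW.contDiffAt hn).isSymmSndFDerivAt (by simp)
  have hd : DifferentiableAt ℝ (fderiv ℝ W) p :=
    ((hW.fderiv_of_isOpen (m := 1) hU (by norm_num)).contDiffAt hn).differentiableAt (by simp)
  have h2 : ∀ w : Spacetime, HasFDerivAt (fun q => fderiv ℝ W q w)
      ((fderiv ℝ (fderiv ℝ W) p).flip w) p := fun w =>
    (hd.hasFDerivAt.clm_apply (hasFDerivAt_const w p)).congr_fderiv (by ext <;> simp)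
  have hc : ∀ i : Fin 2, HasFDerivAt (fun q : Spacetime => q.2 i)
      ((EuclideanSpace.proj i : Plane →L[ℝ] ℝ).comp (ContinuousLinearMap.snd ℝ ℝ Plane)) p :=
    fun i => ((EuclideanSpace.proj i : Plane →L[ℝ] ℝ).comp
      (ContinuousLinearMap.snd ℝ ℝ Plane)).hasFDerivAt
  have hr : HasFDerivAt (rot W) _ p :=
    ((hc 0).mul (h2 (0, EuclideanSpace.single 1 1))).sub
      ((hc 1).mul (h2 (0, EuclideanSpace.single 0 1)))
  have h3 : ∀ w : Spacetime, fderiv ℝ (fun q => fderiv ℝ W q e) p w =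
      fderiv ℝ (fderiv ℝ W) p e w := fun w => by
    rw [(h2 e).fderiv, ContinuousLinearMap.flip_apply]; exact hsymm w e
  rw [hr.fderiv]
  simp only [rot, dx, h3]
  simp
  ring

theorem rot_pd_sq_le {U : Set Spacetime} (hU : IsOpen U) {W : Spacetime → ℝ}
    (hW : ContDiffOn ℝ 2 W U) {p : Spacetime} (hp : p ∈ U) (α : Fin 3) :
    rot (pd α W) p ^ 2 ≤ 2 * pd α (rot W) p ^ 2 + 2 * (dx 0 W p ^ 2 + dx 1 W p ^ 2) := by
  have h := fderiv_rot_apply hU hW hp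
  have key : ∀ A B C D : ℝ, (A = B ∨ A = B + C ∨ A = B - C) → C ^ 2 ≤ D →
      A ^ 2 ≤ 2 * B ^ 2 + 2 * D := by
    rintro A B C D (rfl | rfl | rfl) hD
    · nlinarith [sq_nonneg A, sq_nonneg C]
    · nlinarith [sq_nonneg (B - C)]
    · nlinarith [sq_nonneg (B + C)]
  have h0 := sq_nonneg (dx 0 W p)
  have h1 := sq_nonneg (dx 1 W p)
  fin_cases α
  · refine key _ _ (dx 0 W p) _ (Or.inl ?_) (by linarith)
    have := h (1, 0)
    simp only [PiLp.zero_apply, zero_mul, sub_zero, zero_add] at this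
    exact this.symm
  · refine key _ _ (dx 1 W p) _ (Or.inr (Or.inr ?_)) (by linarith)
    have := h (0, EuclideanSpace.single 0 1)
    simp at this
    change fderiv ℝ (rot W) p _ = _ + rot (dx 0 W) p at this
    change rot (dx 0 W) p = fderiv ℝ (rot W) p (0, EuclideanSpace.single 0 1) - dx 1 W p
    rw [this]; ring
  · refine key _ _ (dx 0 W p) _ (Or.inr (Or.inl ?_)) (by linarith)
    have := h (0, EuclideanSpace.single 1 1)
    simp at this
    change fderiv ℝ (rot W) p _ = _ + rot (dx 1 W) p at this
    change rot (dx 1 W) p = fderiv ℝ (rot W) p (0, EuclideanSpace.single 1 1) + dx 0 W p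
    rw [this]; ring

/-! ### Energy integrals in polar coordinates and the energy density. -/

theorem lintegral_plane_eq (f : Plane → ℝ≥0∞) :
    ∫⁻ y in Ioi (0 : ℝ) ×ˢ Ioo (-Real.pi) Real.pi,
      ENNReal.ofReal y.1 * f !₂[y.1 * Real.cos y.2, y.1 * Real.sin y.2] = ∫⁻ x, f x := by
  let e : ℝ × ℝ ≃ᵐ Plane := MeasurableEquiv.finTwoArrow.symm.trans (MeasurableEquiv.toLp 2 _)
  have he : MeasurePreserving e volume volume :=
    ((volume_preserving_finTwoArrow ℝ).symm _).trans (PiLp.volume_preserving_toLp (Fin 2))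
  rw [← he.lintegral_comp_emb e.measurableEmbedding, ← lintegral_comp_polarCoord_symm]
  rfl

/-- Both the polar Jacobian and the weight are nondecreasing in the radius, so on the strip they are
bounded below by their values at its inner edge. -/
theorem lintegral_density_le {χ aleph : ℝ → ℝ} (hχ : IsCutoff χ) (ha : IsWeightProfile aleph)
    {s η : ℝ} (hs : 2 ≤ s) (hη : 0 ≤ η) (W : Spacetime → ℝ) {r : ℝ} (hr : rhoH s ≤ r) :
    ENNReal.ofReal (r * weight aleph (timeFn χ s r) r ^ (2 * η)) *
      ∫⁻ y in Ioo r (r + 2) ×ˢ Ioo (-Real.pi) Real.pi,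
        ENNReal.ofReal (density χ s W (polarPoint χ s y)) ≤ energyTP χ aleph η s W := by
  have hr0 : 0 < r := by linarith [rhoH_ge hs]
  set f : Plane → ℝ≥0∞ := fun x => ENNReal.ofReal
    (weight aleph (timeFn χ s ‖x‖) ‖x‖ ^ (2 * η) * density χ s W (slicePoint χ s x)) with hf
  have h1 : ∫⁻ x, {x : Plane | rhoH s ≤ ‖x‖}.indicator f x ≤ energyTP χ aleph η s W := by
    rw [lintegral_indicator (measurableSet_le measurable_const measurable_norm), ← base_union]
    exact lintegral_union_le _ _ _
  refine le_trans ?_ h1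
  rw [← lintegral_plane_eq, ← lintegral_const_mul' _ _ ENNReal.ofReal_ne_top]
  have hsub : Ioo r (r + 2) ×ˢ Ioo (-Real.pi) Real.pi ⊆
      Ioi (0 : ℝ) ×ˢ Ioo (-Real.pi) Real.pi :=
    prod_mono (fun x hx => hr0.trans hx.1) subset_rfl
  refine le_trans (setLIntegral_mono' (measurableSet_Ioo.prod measurableSet_Ioo) ?_)
    (lintegral_mono_set hsub)
  rintro y ⟨⟨hy1, -⟩, -⟩
  have hy0 : 0 < y.1 := hr0.trans hy1
  have hn : ‖(!₂[y.1 * Real.cos y.2, y.1 * Real.sin y.2] : Plane)‖ = y.1 :=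
    (norm_polarPoint χ s y).trans (abs_of_pos hy0)
  have hmem : (!₂[y.1 * Real.cos y.2, y.1 * Real.sin y.2] : Plane) ∈
      {x : Plane | rhoH s ≤ ‖x‖} := by
    change rhoH s ≤ ‖_‖
    rw [hn]; exact hr.trans hy1.le
  rw [indicator_of_mem hmem, hf]
  simp only [slicePoint_polar χ s hy0.le, hn]
  have hd : 0 ≤ density χ s W (polarPoint χ s y) := by unfold density; positivity
  have hw := three_le_weight hχ ha hs hr
  have hw2 := weight_mono hχ ha hs hr hy1.le
  rw [← ENNReal.ofReal_mul hy0.le, ← ENNReal.ofReal_mul (by positivity), ← mul_assoc]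
  refine ENNReal.ofReal_le_ofReal (mul_le_mul_of_nonneg_right ?_ hd)
  exact mul_le_mul hy1.le (Real.rpow_le_rpow (by linarith) hw2 (by linarith)) (by positivity) hy0.le

/-- The derivative along the slice in the radial direction. -/
noncomputable def radialD (χ : ℝ → ℝ) (s : ℝ) (v : Spacetime → ℝ) (y : ℝ × ℝ) : ℝ :=
  slope χ s y.1 * dt v (polarPoint χ s y) + Real.cos y.2 * dx 0 v (polarPoint χ s y) +
    Real.sin y.2 * dx 1 v (polarPoint χ s y)

/-- `radialD` is the component of the tangential gradient along the unit vector `(cos, sin)`, so the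
tangential part of the density suffices and `ζ` does not enter. -/
theorem radialD_sq_le (χ : ℝ → ℝ) (s : ℝ) (v : Spacetime → ℝ) {y : ℝ × ℝ} (hy : 0 ≤ y.1) :
    radialD χ s v y ^ 2 ≤ density χ s v (polarPoint χ s y) := by
  have hn : ‖(polarPoint χ s y).2‖ = y.1 := (norm_polarPoint χ s y).trans (abs_of_nonneg hy)
  have h0 : (polarPoint χ s y).2 0 = y.1 * Real.cos y.2 := rfl
  have h1 : (polarPoint χ s y).2 1 = y.1 * Real.sin y.2 := rfl
  have hcs := Real.cos_sq_add_sin_sq y.2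
  have e : radialD χ s v y = Real.cos y.2 * tangD χ s 0 v (polarPoint χ s y) +
      Real.sin y.2 * tangD χ s 1 v (polarPoint χ s y) := by
    simp only [radialD, tangD, hn, h0, h1, slope]
    linear_combination -(xi χ s y.1 * y.1 / Real.sqrt (s ^ 2 + y.1 ^ 2) *
      dt v (polarPoint χ s y)) * hcs
  rw [e, density, Fin.sum_univ_two]
  set A := tangD χ s 0 v (polarPoint χ s y)
  set B := tangD χ s 1 v (polarPoint χ s y)
  have : (Real.cos y.2 * A + Real.sin y.2 * B) ^ 2 + (Real.cos y.2 * B - Real.sin y.2 * A) ^ 2 =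
      A ^ 2 + B ^ 2 := by
    linear_combination (A ^ 2 + B ^ 2) * hcs
  nlinarith [sq_nonneg (Real.cos y.2 * B - Real.sin y.2 * A),
    sq_nonneg (zeta χ s ‖(polarPoint χ s y).2‖ * dt v (polarPoint χ s y))]

theorem density_flat {χ : ℝ → ℝ} (hχ : IsCutoff χ) {s : ℝ} (hs : 2 ≤ s) (v : Spacetime → ℝ)
    {y : ℝ × ℝ} (hy : rhoH s + 1 ≤ y.1) :
    density χ s v (polarPoint χ s y) = dt v (polarPoint χ s y) ^ 2 +
      (dx 0 v (polarPoint χ s y) ^ 2 + dx 1 v (polarPoint χ s y) ^ 2) := by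
  have hn : ‖(polarPoint χ s y).2‖ = y.1 :=
    (norm_polarPoint χ s y).trans (abs_of_nonneg (by linarith [rhoH_ge hs]))
  simp [density, tangD, hn, xi_eq_zero hχ hy, zeta_eq_one hχ hy, Fin.sum_univ_two]

theorem pd_sq_le_density {χ : ℝ → ℝ} (hχ : IsCutoff χ) {s : ℝ} (hs : 2 ≤ s) (v : Spacetime → ℝ)
    {y : ℝ × ℝ} (hy : rhoH s + 1 ≤ y.1) (α : Fin 3) :
    pd α v (polarPoint χ s y) ^ 2 ≤ density χ s v (polarPoint χ s y) := by
  rw [density_flat hχ hs v hy]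
  have h0 := sq_nonneg (dt v (polarPoint χ s y))
  have h1 := sq_nonneg (dx 0 v (polarPoint χ s y))
  have h2 := sq_nonneg (dx 1 v (polarPoint χ s y))
  fin_cases α
  · change dt v (polarPoint χ s y) ^ 2 ≤ _; linarith
  · change dx 0 v (polarPoint χ s y) ^ 2 ≤ _; linarith
  · change dx 1 v (polarPoint χ s y) ^ 2 ≤ _; linarith

/-! ### Weighted Sobolev inequality on a slice. -/

variable {χ : ℝ → ℝ} {s : ℝ} {U : Set Spacetime}

theorem differentiableAt_polarPoint (hs : 2 ≤ s) (hU : IsOpen U) (hsub : tpSlice χ s ⊆ U)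
    {v : Spacetime → ℝ} (hv : ContDiffOn ℝ 1 v U) {y : ℝ × ℝ} (hy : rhoH s ≤ y.1) :
    DifferentiableAt ℝ v (polarPoint χ s y) :=
  (hv.contDiffAt (hU.mem_nhds (hsub (polarPoint_mem hs hy)))).differentiableAt (by simp)

theorem continuousOn_polar (hχ : IsCutoff χ) (hs : 2 ≤ s) (hsub : tpSlice χ s ⊆ U)
    {v : Spacetime → ℝ} (hv : ContinuousOn v U) :
    ContinuousOn (fun y => v (polarPoint χ s y)) {y | rhoH s ≤ y.1} :=
  hv.comp (continuous_polarPoint hχ hs).continuousOn fun _ hy => hsub (polarPoint_mem hs hy)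

theorem continuousOn_radialD (hχ : IsCutoff χ) (hs : 2 ≤ s) (hU : IsOpen U)
    (hsub : tpSlice χ s ⊆ U) {v : Spacetime → ℝ} (hv : ContDiffOn ℝ 1 v U) :
    ContinuousOn (radialD χ s v) {y | rhoH s ≤ y.1} := by
  have h := fun e => continuousOn_polar hχ hs hsub
    (contDiffOn_fderiv_apply (m := 0) hU hv (by norm_num) e).continuousOn
  have hS := continuous_slope hχ hs
  exact (((hS.comp continuous_fst).continuousOn.mul (h _)).add
    ((Real.continuous_cos.comp continuous_snd).continuousOn.mul (h _))).add
    ((Real.continuous_sin.comp continuous_snd).continuousOn.mul (h _))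

theorem aemeasurable_sq_of_continuousOn {g : ℝ × ℝ → ℝ} (hg : ContinuousOn g {y | rhoH s ≤ y.1})
    {a b : ℝ} (ha : rhoH s ≤ a) (c d : ℝ) :
    AEMeasurable (fun y => ENNReal.ofReal (g y ^ 2))
      (volume.restrict (Ioo a b ×ˢ Ioo c d)) :=
  (((hg.mono fun _ hy => ha.trans hy.1.1.le).pow 2).aemeasurable
    (measurableSet_Ioo.prod measurableSet_Ioo)).ennreal_ofReal

/-- The radial Sobolev inequality on each ray, integrated in the angle. The first integral starts at
`r + 1` so that it lies in the flat part whatever `r ≥ rhoH s` is; the factor 4 is twice the length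
of `[r, r + 2]`. -/
theorem lintegral_sq_le (hχ : IsCutoff χ) (hs : 2 ≤ s) (hU : IsOpen U)
    (hsub : tpSlice χ s ⊆ U) {v : Spacetime → ℝ} (hv : ContDiffOn ℝ 1 v U) {r : ℝ}
    (hr : rhoH s ≤ r) (a b : ℝ) :
    ∫⁻ θ in Ioo a b, ENNReal.ofReal (v (polarPoint χ s (r, θ)) ^ 2) ≤
      2 * (∫⁻ y in Ioo (r + 1) (r + 2) ×ˢ Ioo a b, ENNReal.ofReal (v (polarPoint χ s y) ^ 2)) +
      4 * ∫⁻ y in Ioo r (r + 2) ×ˢ Ioo a b, ENNReal.ofReal (density χ s v (polarPoint χ s y)) := by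
  have hr0 : 0 < r := by linarith [rhoH_ge hs]
  have hm1 := aemeasurable_sq_of_continuousOn (continuousOn_polar hχ hs hsub hv.continuousOn)
    (a := r + 1) (b := r + 2) (by linarith) a b
  have hm2 := aemeasurable_sq_of_continuousOn (continuousOn_radialD hχ hs hU hsub hv)
    (b := r + 2) hr a b
  have hm1' := hm1
  have hm2' := hm2
  rw [Measure.volume_eq_prod, ← Measure.prod_restrict] at hm1' hm2'
  have h1 : ∀ θ, ENNReal.ofReal (v (polarPoint χ s (r, θ)) ^ 2) ≤
      2 * (∫⁻ ρ in Ioo (r + 1) (r + 2), ENNReal.ofReal (v (polarPoint χ s (ρ, θ)) ^ 2)) +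
      4 * ∫⁻ ρ in Ioo r (r + 2), ENNReal.ofReal (radialD χ s v (ρ, θ) ^ 2) := by
    intro θ
    have := ofReal_sq_le_sobolev (f := fun ρ => v (polarPoint χ s (ρ, θ)))
      (f' := fun ρ => radialD χ s v (ρ, θ)) (a := r) (b := r + 2) (c := r + 1) (d := r + 2) (x := r)
      (by linarith) (by linarith) le_rfl
      (fun ρ hρ => hasDerivAt_radial hχ hs
        (differentiableAt_polarPoint hs hU hsub hv (hr.trans hρ.1)))
      ((continuousOn_radialD hχ hs hU hsub hv).comp (by fun_prop) fun ρ hρ => hr.trans hρ.1)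
      (by constructor <;> linarith)
    refine this.trans_eq ?_
    rw [show (2 : ℝ) * (r + 2 - r) = 4 by ring]
    norm_num
  refine (lintegral_mono h1).trans ?_
  rw [lintegral_add_left' (hm1'.lintegral_prod_left'.const_mul 2),
    lintegral_const_mul'' _ hm1'.lintegral_prod_left',
    lintegral_const_mul'' _ hm2'.lintegral_prod_left', ← lintegral_prod_symm _ hm1',
    ← lintegral_prod_symm _ hm2', Measure.prod_restrict, Measure.prod_restrict,
    ← Measure.volume_eq_prod]
  refine add_le_add le_rfl (mul_le_mul_right ?_ _)
  refine setLIntegral_mono' (measurableSet_Ioo.prod measurableSet_Ioo) fun y hy => ?_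
  exact ENNReal.ofReal_le_ofReal (radialD_sq_le χ s v (hr0.trans hy.1.1).le)

theorem ofReal_sq_le_angular (hs : 2 ≤ s) (hχ : IsCutoff χ) (hU : IsOpen U)
    (hsub : tpSlice χ s ⊆ U) {v : Spacetime → ℝ} (hv : ContDiffOn ℝ 1 v U) {y : ℝ × ℝ}
    (hy : rhoH s ≤ y.1) (hθ : y.2 ∈ Icc (-Real.pi) Real.pi) :
    ENNReal.ofReal (v (polarPoint χ s y) ^ 2) ≤
      2 * (∫⁻ θ in Ioo (-Real.pi) Real.pi, ENNReal.ofReal (v (polarPoint χ s (y.1, θ)) ^ 2)) +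
      16 * ∫⁻ θ in Ioo (-Real.pi) Real.pi,
        ENNReal.ofReal (rot v (polarPoint χ s (y.1, θ)) ^ 2) := by
  have hπ := Real.pi_gt_three
  have hπ' := Real.pi_le_four
  have hrot : ContinuousOn (rot v) U :=
    (contDiffOn_act (m := 0) hU hv (by norm_num) (.inr (.inr ()))).continuousOn
  have := ofReal_sq_le_sobolev (f := fun θ => v (polarPoint χ s (y.1, θ)))
    (f' := fun θ => rot v (polarPoint χ s (y.1, θ))) (a := -Real.pi) (b := Real.pi)
    (c := -Real.pi) (d := Real.pi) (x := y.2) le_rfl (by linarith) le_rfl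
    (fun θ _ => hasDerivAt_angular (differentiableAt_polarPoint hs hU hsub hv hy))
    ((continuousOn_polar hχ hs hsub hrot).comp (by fun_prop) fun θ _ => hy) hθ
  refine this.trans (add_le_add le_rfl (mul_le_mul_left ?_ _))
  -- Twice the length of the angular interval is `4 π`, and `π ≤ 4`.
  rw [show (16 : ℝ≥0∞) = ENNReal.ofReal 16 by simp]
  exact ENNReal.ofReal_le_ofReal (by linarith)

/-- Weighted Sobolev inequality for first derivatives on the exterior part of a slice. -/
theorem ofReal_pd_sq_le {aleph : ℝ → ℝ} (hχ : IsCutoff χ) (ha : IsWeightProfile aleph) {η : ℝ}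
    (hs : 2 ≤ s) (hη : 0 ≤ η) (hU : IsOpen U) (hsub : tpSlice χ s ⊆ U) {W : Spacetime → ℝ}
    (hW : ContDiffOn ℝ 3 W U) {y : ℝ × ℝ} (hy : rhoH s ≤ y.1)
    (hθ : y.2 ∈ Icc (-Real.pi) Real.pi) (α : Fin 3) :
    ENNReal.ofReal (y.1 * weight aleph (timeFn χ s y.1) y.1 ^ (2 * η) *
        pd α W (polarPoint χ s y) ^ 2) ≤
      136 * (energyTP χ aleph η s W + energyTP χ aleph η s (rot W) +
        energyTP χ aleph η s (pd α W) + energyTP χ aleph η s (rot (pd α W))) := by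
  have hr0 : 0 < y.1 := by linarith [rhoH_ge hs]
  have hw := three_le_weight hχ ha hs hy
  set v := pd α W with hvdef
  have hv : ContDiffOn ℝ 2 v U := contDiffOn_act hU hW (by norm_num) (.inl α)
  have hv1 : ContDiffOn ℝ 1 v U := hv.of_le (by norm_num)
  have hrv : ContDiffOn ℝ 1 (rot v) U := contDiffOn_act hU hv (by norm_num) (.inr (.inr ()))
  have hrW : ContDiffOn ℝ 2 (rot W) U := contDiffOn_act hU hW (by norm_num) (.inr (.inr ()))
  have hprW : ContinuousOn (pd α (rot W)) U :=
    (contDiffOn_act (m := 1) hU hrW (by norm_num) (.inl α)).continuousOn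
  set I : (Spacetime → ℝ) → ℝ≥0∞ := fun V =>
    ∫⁻ z in Ioo y.1 (y.1 + 2) ×ˢ Ioo (-Real.pi) Real.pi,
      ENNReal.ofReal (density χ s V (polarPoint χ s z)) with hI
  have hDm : MeasurableSet (Ioo (y.1 + 1) (y.1 + 2) ×ˢ Ioo (-Real.pi) Real.pi) :=
    measurableSet_Ioo.prod measurableSet_Ioo
  have hDD : Ioo (y.1 + 1) (y.1 + 2) ×ˢ Ioo (-Real.pi) Real.pi ⊆
      Ioo y.1 (y.1 + 2) ×ˢ Ioo (-Real.pi) Real.pi :=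
    prod_mono (Ioo_subset_Ioo (by linarith) le_rfl) subset_rfl
  have hflat : ∀ (g : ℝ × ℝ → ℝ) (V : Spacetime → ℝ),
      (∀ z : ℝ × ℝ, rhoH s + 1 ≤ z.1 → g z ≤ density χ s V (polarPoint χ s z)) →
      ∫⁻ z in Ioo (y.1 + 1) (y.1 + 2) ×ˢ Ioo (-Real.pi) Real.pi, ENNReal.ofReal (g z) ≤ I V := by
    intro g V h
    refine (setLIntegral_mono' hDm fun z hz => ?_).trans (lintegral_mono_set hDD)
    exact ENNReal.ofReal_le_ofReal (h z (by linarith [hz.1.1]))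
  have hB1 : ∫⁻ z in Ioo (y.1 + 1) (y.1 + 2) ×ˢ Ioo (-Real.pi) Real.pi,
      ENNReal.ofReal (v (polarPoint χ s z) ^ 2) ≤ I W :=
    hflat _ W fun z hz => pd_sq_le_density hχ hs W hz α
  have hB2 : ∫⁻ z in Ioo (y.1 + 1) (y.1 + 2) ×ˢ Ioo (-Real.pi) Real.pi,
      -- Here `Ω ∂_α W` is traded for `∂_α Ω W` and first derivatives of `W`, all controlled by
      -- densities on the flat part.
      ENNReal.ofReal (rot v (polarPoint χ s z) ^ 2) ≤ 2 * I (rot W) + 2 * I W := by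
    have h1 : ∀ z ∈ Ioo (y.1 + 1) (y.1 + 2) ×ˢ Ioo (-Real.pi) Real.pi,
        ENNReal.ofReal (rot v (polarPoint χ s z) ^ 2) ≤
        2 * ENNReal.ofReal (pd α (rot W) (polarPoint χ s z) ^ 2) +
        2 * ENNReal.ofReal (dx 0 W (polarPoint χ s z) ^ 2 + dx 1 W (polarPoint χ s z) ^ 2) := by
      intro z hz
      have hzU := hsub (polarPoint_mem (χ := χ) hs (y := z) (by linarith [hz.1.1]))
      rw [show (2 : ℝ≥0∞) = ENNReal.ofReal 2 by simp, ← ENNReal.ofReal_mul (by norm_num),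
        ← ENNReal.ofReal_mul (by norm_num), ← ENNReal.ofReal_add (by positivity) (by positivity)]
      exact ENNReal.ofReal_le_ofReal (rot_pd_sq_le hU (hW.of_le (by norm_num)) hzU α)
    have hm := aemeasurable_sq_of_continuousOn (continuousOn_polar hχ hs hsub hprW)
      (a := y.1 + 1) (b := y.1 + 2) (by linarith) (-Real.pi) Real.pi
    refine (setLIntegral_mono' hDm h1).trans ?_
    rw [lintegral_add_left' (hm.const_mul 2), lintegral_const_mul' _ _ (by norm_num),
      lintegral_const_mul' _ _ (by norm_num)]
    refine add_le_add (mul_le_mul_right (hflat _ _ fun z hz =>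
      pd_sq_le_density hχ hs _ hz α) _) (mul_le_mul_right (hflat _ _ fun z hz => ?_) _)
    rw [density_flat hχ hs W hz]
    linarith [sq_nonneg (dt W (polarPoint χ s z))]
  have hA : ENNReal.ofReal (v (polarPoint χ s y) ^ 2) ≤
      136 * (I W + I (rot W) + I v + I (rot v)) := by
    calc ENNReal.ofReal (v (polarPoint χ s y) ^ 2)
        ≤ 2 * (2 * I W + 4 * I v) + 16 * (2 * (2 * I (rot W) + 2 * I W) + 4 * I (rot v)) := by
          refine (ofReal_sq_le_angular hs hχ hU hsub hv1 hy hθ).trans ?_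
          refine add_le_add (mul_le_mul_right ?_ _) (mul_le_mul_right ?_ _)
          · refine (lintegral_sq_le hχ hs hU hsub hv1 hy _ _).trans ?_
            exact add_le_add (mul_le_mul_right hB1 _) le_rfl
          · refine (lintegral_sq_le hχ hs hU hsub hrv hy _ _).trans ?_
            exact add_le_add (mul_le_mul_right hB2 _) le_rfl
      _ = 68 * I W + 64 * I (rot W) + 8 * I v + 64 * I (rot v) := by ring
      _ ≤ 136 * I W + 136 * I (rot W) + 136 * I v + 136 * I (rot v) := by
          gcongr <;> norm_num
      _ = _ := by ring
  rw [ENNReal.ofReal_mul (by positivity)]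
  refine (mul_le_mul_right hA _).trans ?_
  have hE := fun V => lintegral_density_le hχ ha hs hη V hy
  rw [mul_left_comm]
  refine mul_le_mul_right ?_ _
  rw [mul_add, mul_add, mul_add]
  exact (add_le_add (add_le_add (add_le_add (hE _) (hE _)) (hE _)) (hE _))

theorem energyTP_foldr_le (χ aleph : ℝ → ℝ) (η s : ℝ) (u : Spacetime → ℝ) (l : List Field)
    (hl : l.length ≤ 3) :
    energyTP χ aleph η s (l.foldr Field.act u) ≤ energyTPOrd χ aleph 3 3 η s u := by
  -- The rank is at most the length, so the restriction on rank excludes nothing.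
  have hr : rank l.get ≤ 3 := by
    refine le_trans ?_ hl
    exact (Finset.card_filter_le _ _).trans_eq (by simp)
  have hc : compose l.get u = l.foldr Field.act u := by rw [compose, List.ofFn_get]
  unfold energyTPOrd
  refine le_trans ?_ (Finset.single_le_sum (fun _ _ => zero_le)
    (Finset.mem_range.2 (by omega : l.length < 3 + 1)))
  refine le_trans ?_ (Finset.single_le_sum (fun _ _ => zero_le) (Finset.mem_univ l.get))
  simp only [if_pos hr, hc, le_refl]

/-- The list `l` is empty or one field, as the Sobolev inequality adds up to two more and the energy
allows three in all. -/
theorem abs_pd_le {χ aleph : ℝ → ℝ} (hχ : IsCutoff χ) (ha : IsWeightProfile aleph) {s η : ℝ}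
    (hs : 2 ≤ s) (hη : 0 ≤ η) {U : Set Spacetime} (hU : IsOpen U) (hsub : tpSlice χ s ⊆ U)
    {u : Spacetime → ℝ} {l : List Field} (hl : l.length ≤ 1)
    (hW : ContDiffOn ℝ 3 (l.foldr Field.act u) U)
    (hE : energyTPOrd χ aleph 3 3 η s u ≠ ⊤) {y : ℝ × ℝ} (hy : rhoH s ≤ y.1)
    (hθ : y.2 ∈ Icc (-Real.pi) Real.pi) (α : Fin 3) :
    y.1 ^ (1 / 2 : ℝ) * weight aleph (timeFn χ s y.1) y.1 ^ η *
        |pd α (l.foldr Field.act u) (polarPoint χ s y)| ≤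
      24 * (energyTPOrd χ aleph 3 3 η s u).toReal ^ (1 / 2 : ℝ) := by
  set W := l.foldr Field.act u with hWdef
  have hr0 : 0 < y.1 := by linarith [rhoH_ge hs]
  have hw := three_le_weight hχ ha hs hy
  have hb := fun l' => energyTP_foldr_le χ aleph η s u l'
  have h0 := hb l (by omega)
  have h1 := hb (.inr (.inr ()) :: l) (by simp; omega)
  have h2 := hb (.inl α :: l) (by simp; omega)
  have h3 := hb (.inr (.inr ()) :: .inl α :: l) (by simp; omega)
  have h := ofReal_pd_sq_le (η := η) hχ ha hs hη hU hsub hW hy hθ α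
  set e := (energyTPOrd χ aleph 3 3 η s u).toReal with he
  have he0 : 0 ≤ e := ENNReal.toReal_nonneg
  -- Four energies with constant 136 give `544 ≤ 24²`.
  have h4 : ENNReal.ofReal (y.1 * weight aleph (timeFn χ s y.1) y.1 ^ (2 * η) *
        pd α W (polarPoint χ s y) ^ 2) ≤ ENNReal.ofReal (544 * e) := by
    refine h.trans ((mul_le_mul_right (add_le_add (add_le_add (add_le_add h0 h1) h2) h3) _).trans ?_)
    rw [ENNReal.ofReal_mul (by norm_num), ENNReal.ofReal_toReal hE]
    rw [show ENNReal.ofReal 544 = 544 by simp]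
    apply le_of_eq; ring
  rw [ENNReal.ofReal_le_ofReal_iff (by positivity)] at h4
  rw [← Real.sqrt_eq_rpow, ← Real.sqrt_eq_rpow]
  refine abs_le_of_sq_le_sq' ?_ (by positivity) |>.2
  rw [mul_pow, mul_pow, mul_pow, Real.sq_sqrt hr0.le, Real.sq_sqrt he0, sq_abs,
    ← Real.rpow_mul_natCast (by linarith), Nat.cast_ofNat, mul_comm η 2]
  linarith

/-! ### Boosts and semi-null derivatives. -/

theorem bracket_le {r : ℝ} (hr : 1 ≤ r) : bracket r ≤ 2 * r :=
  Real.sqrt_le_iff.2 ⟨by linarith, by nlinarith⟩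

theorem bracket_pos (r : ℝ) : 0 < bracket r := Real.sqrt_pos.2 (by positivity)

theorem bracket_rpow_half_le {r : ℝ} (hr : 1 ≤ r) :
    bracket r ^ (1 / 2 : ℝ) ≤ 2 * r ^ (1 / 2 : ℝ) := by
  rw [← Real.sqrt_eq_rpow, ← Real.sqrt_eq_rpow]
  refine Real.sqrt_le_iff.2 ⟨by positivity, ?_⟩
  rw [mul_pow, Real.sq_sqrt (by linarith)]
  linarith [bracket_le hr]

/-- `c ^ p ≤ c` in the form in which constants are pulled out of powers with exponent at most 1. -/
theorem rpow_const_mul_le {c x p : ℝ} (hc : 1 ≤ c) (hx : 0 ≤ x) (hp1 : p ≤ 1) :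
    (c * x) ^ p ≤ c * x ^ p := by
  rw [Real.mul_rpow (by linarith) hx]
  refine mul_le_mul_of_nonneg_right ?_ (Real.rpow_nonneg hx _)
  simpa using Real.rpow_le_rpow_of_exponent_le hc hp1

theorem abs_coord_le (p : Spacetime) (a : Fin 2) : |p.2 a| ≤ ‖p.2‖ := by
  simpa using PiLp.norm_apply_le p.2 a

/-- Integration inward from `r = 2 ρ_H + 2`, where the weight is comparable to `r`. -/
theorem abs_le_of_integration {f f' : ℝ → ℝ} {R M η r : ℝ} (hR : 3 / 2 ≤ R) (hM : 0 ≤ M)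
    (hη : 0 < η) (hη1 : η < 1) (hr : r ∈ Icc R (2 * R + 2))
    (hf : ∀ x, R ≤ x → HasDerivAt f (f' x) x)
    (hf' : ∀ x, R ≤ x → |f' x| ≤ 3 * M * R ^ (-(1 / 2) : ℝ) * (x - R + 2) ^ (-η))
    (hend : |f (2 * R + 2)| ≤ 4 * M * R ^ (1 / 2 - η)) :
    |f r| ≤ 16 * M * R ^ (1 / 2 - η) * (1 - η)⁻¹ := by
  have hη' : 0 < 1 - η := by linarith
  have hR0 : 0 < R := by linarith
  set k := 3 * M * R ^ (-(1 / 2) : ℝ) with hk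
  have hk0 : 0 ≤ k := by positivity
  have hB : ∀ x, R ≤ x → HasDerivAt (fun x => k * ((x - R + 2) ^ (1 - η) * (1 - η)⁻¹))
      (k * (x - R + 2) ^ (-η)) x := by
    intro x hx
    have h1 : HasDerivAt (fun x : ℝ => x - R + 2) 1 x := ((hasDerivAt_id x).sub_const R).add_const 2
    have h2 := ((h1.rpow_const (p := 1 - η) (Or.inl (by linarith))).mul_const (1 - η)⁻¹).const_mul k
    refine h2.congr_deriv ?_
    rw [show 1 - η - 1 = -η by ring]
    field_simp
  set B := fun x => k * ((x - R + 2) ^ (1 - η) * (1 - η)⁻¹) with hBdef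
  -- Comparison with a primitive `B` of the majorant, both shifted to vanish at `r`; the factor `(1
  -- - η)⁻¹` of the theorem originates in `B`.
  have h := image_norm_le_of_norm_deriv_right_le_deriv_boundary' (a := r) (b := 2 * R + 2)
    (f := fun x => f x - f r) (f' := f') (B := fun x => B x - B r)
    (B' := fun x => k * (x - R + 2) ^ (-η))
    (fun x hx => ((hf x (hr.1.trans hx.1)).sub_const _).continuousAt.continuousWithinAt)
    (fun x hx => ((hf x (hr.1.trans hx.1)).sub_const _).hasDerivWithinAt)
    (by simp)
    (fun x hx => ((hB x (hr.1.trans hx.1)).sub_const _).continuousAt.continuousWithinAt)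
    (fun x hx => ((hB x (hr.1.trans hx.1)).sub_const _).hasDerivWithinAt)
    (fun x hx => hf' x (hr.1.trans hx.1)) (right_mem_Icc.2 hr.2)
  rw [Real.norm_eq_abs] at h
  have hBr : 0 ≤ B r := by
    have : 0 ≤ r - R + 2 := by linarith [hr.1]
    positivity
  have hpow : R ^ (-(1 / 2) : ℝ) * R ^ (1 - η) = R ^ (1 / 2 - η) := by
    rw [← Real.rpow_add hR0]; congr 1; ring
  have hBe : B (2 * R + 2) ≤ 12 * M * R ^ (1 / 2 - η) * (1 - η)⁻¹ := by
    -- As `R ≥ 3 / 2`, the end value `R + 4` is at most `4 R`.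
    have h1 : (2 * R + 2 - R + 2) ^ (1 - η) ≤ 4 * R ^ (1 - η) :=
      (Real.rpow_le_rpow (by linarith) (by linarith : 2 * R + 2 - R + 2 ≤ 4 * R) hη'.le).trans
        (rpow_const_mul_le (by norm_num) hR0.le (by linarith))
    calc B (2 * R + 2) ≤ k * ((4 * R ^ (1 - η)) * (1 - η)⁻¹) := by
          simp only [hBdef]; gcongr
      _ = 12 * M * (R ^ (-(1 / 2) : ℝ) * R ^ (1 - η)) * (1 - η)⁻¹ := by rw [hk]; ring
      _ = _ := by rw [hpow]
  have hone : 1 ≤ (1 - η)⁻¹ := one_le_inv₀ hη' |>.2 (by linarith)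
  have hX : 0 ≤ 4 * M * R ^ (1 / 2 - η) := by positivity
  have h5 : 4 * M * R ^ (1 / 2 - η) ≤ 4 * M * R ^ (1 / 2 - η) * (1 - η)⁻¹ :=
    le_mul_of_one_le_right hX hone
  have h6 : |f r| ≤ |f (2 * R + 2)| + |f (2 * R + 2) - f r| := by
    have := abs_sub_abs_le_abs_sub (f r) (f (2 * R + 2))
    rw [abs_sub_comm] at this
    linarith
  nlinarith

theorem weight_ge_sub {χ aleph : ℝ → ℝ} (hχ : IsCutoff χ) (ha : IsWeightProfile aleph) {s : ℝ}
    (hs : 2 ≤ s) {r : ℝ} (hr : rhoH s ≤ r) :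
    r - rhoH s + 2 ≤ weight aleph (timeFn χ s r) r := by
  rw [weight_eq hχ ha hs hr]
  linarith [(timeFn_mem_Icc hχ hs hr).2]

theorem abs_boost_le {χ aleph : ℝ → ℝ} (hχ : IsCutoff χ) (ha : IsWeightProfile aleph) {s η M : ℝ}
    (hs : 2 ≤ s) (hη : 0 < η) (hη1 : η < 1) (hM : 0 ≤ M) {U : Set Spacetime} (hU : IsOpen U)
    (hsub : tpSlice χ s ⊆ U) {u : Spacetime → ℝ} (a : Fin 2)
    (hW : ContDiffOn ℝ 1 (boost a u) U) {θ : ℝ}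
    (hu : ∀ r, rhoH s ≤ r → ∀ α, r ^ (1 / 2 : ℝ) * weight aleph (timeFn χ s r) r ^ η *
        |pd α u (polarPoint χ s (r, θ))| ≤ M)
    (hLu : ∀ r, rhoH s ≤ r → ∀ α, r ^ (1 / 2 : ℝ) * weight aleph (timeFn χ s r) r ^ η *
        |pd α (boost a u) (polarPoint χ s (r, θ))| ≤ M)
    {r : ℝ} (hr : r ∈ Icc (rhoH s) (2 * rhoH s + 2)) :
    |boost a u (polarPoint χ s (r, θ))| ≤ 16 * M * rhoH s ^ (1 / 2 - η) * (1 - η)⁻¹ := by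
  have hR := rhoH_ge hs
  set R := rhoH s with hRdef
  have hR0 : 0 < R := by linarith
  refine abs_le_of_integration (f := fun ρ => boost a u (polarPoint χ s (ρ, θ)))
    (f' := fun ρ => radialD χ s (boost a u) (ρ, θ)) hR hM hη hη1 hr
    (fun x hx => hasDerivAt_radial hχ hs (differentiableAt_polarPoint hs hU hsub hW hx)) ?_ ?_
  · intro x hx
    have hx0 : 0 < x := by linarith
    have hw := weight_ge_sub hχ ha hs hx
    have hw0 : 0 < x - R + 2 := by linarith
    have hb : ∀ α, |pd α (boost a u) (polarPoint χ s (x, θ))| ≤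
        M * R ^ (-(1 / 2) : ℝ) * (x - R + 2) ^ (-η) := by
      intro α
      have h1 : R ^ (1 / 2 : ℝ) * (x - R + 2) ^ η * |pd α (boost a u) (polarPoint χ s (x, θ))| ≤ M := by
        refine le_trans ?_ (hLu x hx α)
        gcongr
      rw [Real.rpow_neg hR0.le, Real.rpow_neg hw0.le, ← div_eq_mul_inv, ← div_eq_mul_inv, div_div,
        le_div_iff₀ (by positivity)]
      linarith
    have hS := slope_mem_Icc hχ hs hx0.le
    have habs : ∀ c d : ℝ, |c| ≤ 1 → |c * d| ≤ |d| := fun c d hc => by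
      rw [abs_mul]; exact mul_le_of_le_one_left (abs_nonneg d) hc
    have e0 := (habs (slope χ s x) (dt (boost a u) (polarPoint χ s (x, θ)))
      (abs_le.2 ⟨by linarith [hS.1], hS.2⟩)).trans (hb 0)
    have e1 := (habs _ (dx 0 (boost a u) (polarPoint χ s (x, θ))) (Real.abs_cos_le_one θ)).trans
      (hb 1)
    have e2 := (habs _ (dx 1 (boost a u) (polarPoint χ s (x, θ))) (Real.abs_sin_le_one θ)).trans
      (hb 2)
    refine (abs_add_three _ _ _).trans ((add_le_add (add_le_add e0 e1) e2).trans_eq ?_)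
    ring
  · have hr1 : rhoH s ≤ 2 * R + 2 := by linarith
    set q := polarPoint χ s (2 * R + 2, θ) with hq
    have hw := weight_ge_sub hχ ha hs hr1
    have hT := timeFn_mem_Icc hχ hs hr1
    have hn : |q.2 a| ≤ 2 * R + 2 := by
      refine (abs_coord_le _ _).trans ?_
      rw [norm_polarPoint, abs_of_nonneg]
      simp only; linarith
    have ht : |q.1| ≤ 2 * R + 2 := by
      change |timeFn χ s (2 * R + 2)| ≤ _
      rw [abs_of_nonneg] <;> linarith [hT.1, hT.2]
    set m := (2 * R + 2) ^ (1 / 2 : ℝ) with hm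
    have hm0 : 0 < m := by positivity
    -- The boost coefficients have size `m²`: one factor `m` is absorbed by the decay of `∂u`, the
    -- other leaves `R ^ (1/2)`.
    have hmm : 2 * R + 2 = m * m := by
      rw [hm, ← Real.rpow_add (by positivity)]; norm_num
    have hm2 : m ≤ 2 * R ^ (1 / 2 : ℝ) := by
      rw [hm, ← Real.sqrt_eq_rpow, ← Real.sqrt_eq_rpow]
      refine Real.sqrt_le_iff.2 ⟨by positivity, ?_⟩
      rw [mul_pow, Real.sq_sqrt hR0.le]; linarith
    have hb : ∀ α, m * |pd α u q| ≤ M * R ^ (-η) := by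
      intro α
      have h1 : m * R ^ η * |pd α u q| ≤ M := by
        refine le_trans ?_ (hu _ hr1 α)
        gcongr
        linarith
      rw [Real.rpow_neg hR0.le, ← div_eq_mul_inv, le_div_iff₀ (by positivity)]
      linarith
    have hb' : ∀ c α, |c| ≤ 2 * R + 2 → |c * pd α u q| ≤ 2 * M * R ^ (1 / 2 - η) := by
      intro c α hc
      rw [abs_mul]
      calc |c| * |pd α u q| ≤ (m * m) * |pd α u q| := by rw [← hmm]; gcongr
        _ = m * (m * |pd α u q|) := by ring
        _ ≤ (2 * R ^ (1 / 2 : ℝ)) * (M * R ^ (-η)) := by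
            have := hb α
            gcongr
        _ = 2 * M * R ^ (1 / 2 - η) := by
            rw [sub_eq_add_neg, Real.rpow_add hR0]; ring
    have e := (abs_add_le _ _).trans (add_le_add (hb' (q.2 a) 0 hn) (hb' q.1 a.succ ht))
    refine e.trans_eq (by ring)

/-- Solving the boost for `∂_a` leaves a time derivative with the small factor `(t - r) / t`, which
the weight compensates. -/
theorem nullD_eq (a : Fin 2) (u : Spacetime → ℝ) {p : Spacetime} (ht : p.1 ≠ 0)
    (hp : ‖p.2‖ ≠ 0) :
    nullD a u p = boost a u p / p.1 + p.2 a / ‖p.2‖ * ((p.1 - ‖p.2‖) / p.1) * dt u p := by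
  unfold nullD boost
  field_simp
  ring

/-- The pointwise bounds on `∂u` and on the boosts give the bound on the semi-null derivatives. -/
theorem bracket_mul_nullD_le {χ aleph : ℝ → ℝ} (hχ : IsCutoff χ) (ha : IsWeightProfile aleph)
    {s η M : ℝ} (hs : 2 ≤ s) (hη : 0 < η) (hη1 : η < 1) (hM : 0 ≤ M) {u : Spacetime → ℝ} (a : Fin 2)
    {y : ℝ × ℝ} (hy : rhoH s ≤ y.1)
    (hu : ∀ α, bracket y.1 ^ (1 / 2 : ℝ) * weight aleph (timeFn χ s y.1) y.1 ^ η *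
        |pd α u (polarPoint χ s y)| ≤ 2 * M)
    (hL : y.1 ≤ 2 * rhoH s + 2 →
      |boost a u (polarPoint χ s y)| ≤ 16 * M * rhoH s ^ (1 / 2 - η) * (1 - η)⁻¹) :
    bracket y.1 ^ (1 / 2 + η) * |nullD a u (polarPoint χ s y)| ≤ 1072 * M * (1 - η)⁻¹ := by
  have hR := rhoH_ge hs
  have hT := timeFn_mem_Icc hχ hs hy
  have hw := three_le_weight hχ ha hs hy
  have hweq := weight_eq hχ ha hs hy
  set R := rhoH s with hRdef
  set w := weight aleph (timeFn χ s y.1) y.1 with hwdef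
  set b := bracket y.1 with hb
  set q := polarPoint χ s y with hq
  have hR0 : 0 < R := by linarith
  have hr0 : 0 < y.1 := by linarith
  have hw0 : 0 < w := by linarith
  have hη' : 0 < 1 - η := by linarith
  have hone : 1 ≤ (1 - η)⁻¹ := one_le_inv₀ hη' |>.2 (by linarith)
  have hb0 : 0 < b := bracket_pos _
  have hb2 : b ≤ 2 * y.1 := bracket_le (by linarith)
  have hn : ‖q.2‖ = y.1 := (norm_polarPoint χ s y).trans (abs_of_pos hr0)
  have hq1 : q.1 = timeFn χ s y.1 := rfl
  have hfrac : |q.2 a / ‖q.2‖| ≤ 1 := by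
    rw [abs_div, abs_norm, div_le_one (by rw [hn]; exact hr0)]
    exact abs_coord_le q a
  have hbη : b ^ (1 / 2 + η) = b ^ (1 / 2 : ℝ) * b ^ η := Real.rpow_add hb0 _ _
  have hMM : M ≤ M * (1 - η)⁻¹ := le_mul_of_one_le_right hM hone
  rcases le_total y.1 (2 * R + 2) with hc | hc
  · have hbR : b ≤ 8 * R := by linarith
    have hwR : w ≤ 8 * R := by linarith [hT.1]
    have ht0 : 0 < q.1 := by rw [hq1]; linarith [hT.1]
    have htR : R ≤ q.1 := by rw [hq1]; linarith [hT.1]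
    have hA : b ^ (1 / 2 + η) * |boost a u q / q.1| ≤ 1024 * (M * (1 - η)⁻¹) := by
      have h1 : b ^ (1 / 2 + η) ≤ 64 * R ^ (1 / 2 + η) := by
        refine (Real.rpow_le_rpow hb0.le hbR (by linarith)).trans ?_
        rw [Real.mul_rpow (by norm_num) hR0.le]
        refine mul_le_mul_of_nonneg_right ?_ (by positivity)
        -- The constant 64 is `8²`, a bound for `8 ^ (1/2 + η)` uniform in `η`.
        have := Real.rpow_le_rpow_of_exponent_le (by norm_num : (1 : ℝ) ≤ 8)
          (by linarith : 1 / 2 + η ≤ 2)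
        refine this.trans_eq ?_
        norm_num
      have h2 : R ^ (1 / 2 + η) * R ^ (1 / 2 - η) = R := by
        rw [← Real.rpow_add hR0, show 1 / 2 + η + (1 / 2 - η) = 1 by ring, Real.rpow_one]
      rw [abs_div, abs_of_pos ht0]
      calc b ^ (1 / 2 + η) * (|boost a u q| / q.1)
          ≤ (64 * R ^ (1 / 2 + η)) * ((16 * M * R ^ (1 / 2 - η) * (1 - η)⁻¹) / R) := by
            have := hL hc
            gcongr
        _ = 1024 * (M * (1 - η)⁻¹) * ((R ^ (1 / 2 + η) * R ^ (1 / 2 - η)) / R) := by ring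
        _ = 1024 * (M * (1 - η)⁻¹) := by rw [h2, div_self hR0.ne', mul_one]
    have hB : b ^ (1 / 2 + η) * |q.2 a / ‖q.2‖ * ((q.1 - ‖q.2‖) / q.1) * dt u q| ≤ 48 * M := by
      have h1 : |(q.1 - ‖q.2‖) / q.1| ≤ 3 * w / R := by
        rw [abs_div, abs_of_pos ht0]
        gcongr
        rw [hn, hq1, abs_le]
        constructor <;> linarith
      have h2 : b ^ η * w ^ (1 - η) ≤ 8 * R := by
        calc b ^ η * w ^ (1 - η) ≤ (8 * R) ^ η * (8 * R) ^ (1 - η) := by gcongr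
          _ = 8 * R := by
            rw [← Real.rpow_add (by positivity), show η + (1 - η) = 1 by ring, Real.rpow_one]
      -- Splitting `w` supplies the `w ^ η` needed for the gradient bound; the remaining `w ^ (1 -
      -- η)` combines with `b ^ η` to at most `8 R`, cancelling the `1 / R` from `1 / t`.
      have h3 : w = w ^ η * w ^ (1 - η) := by
        rw [← Real.rpow_add hw0, show η + (1 - η) = 1 by ring, Real.rpow_one]
      have h4 : |q.2 a / ‖q.2‖ * ((q.1 - ‖q.2‖) / q.1) * dt u q| ≤ 3 * w / R * |dt u q| := by
        rw [abs_mul, abs_mul]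
        refine mul_le_mul_of_nonneg_right ?_ (abs_nonneg _)
        exact (mul_le_of_le_one_left (abs_nonneg _) hfrac).trans h1
      calc b ^ (1 / 2 + η) * |q.2 a / ‖q.2‖ * ((q.1 - ‖q.2‖) / q.1) * dt u q|
          ≤ b ^ (1 / 2 + η) * (3 * w / R * |dt u q|) := by gcongr
        _ = 3 * (b ^ (1 / 2 : ℝ) * w ^ η * |dt u q|) * ((b ^ η * w ^ (1 - η)) / R) := by
            rw [hbη]
            nth_rw 1 [h3]
            ring
        _ ≤ 3 * (2 * M) * ((8 * R) / R) := by
            have := hu 0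
            change _ * |dt u q| ≤ _ at this
            gcongr
        _ = 48 * M := by field_simp; ring
    rw [nullD_eq a u ht0.ne' (by rw [hn]; exact hr0.ne')]
    calc _ ≤ b ^ (1 / 2 + η) * (|boost a u q / q.1| +
            |q.2 a / ‖q.2‖ * ((q.1 - ‖q.2‖) / q.1) * dt u q|) := by
          gcongr; exact abs_add_le _ _
      _ ≤ 1024 * (M * (1 - η)⁻¹) + 48 * M := by rw [mul_add]; exact add_le_add hA hB
      _ ≤ _ := by linarith
  -- Far out, `r ≥ 2 R + 2` and `w ≥ r - R + 2` make the weight comparable to `r`, so no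
  -- cancellation in `nullD` is needed.
  · have hbw : b ≤ 4 * w := by linarith [hT.2]
    have h1 : b ^ η ≤ 4 * w ^ η := (Real.rpow_le_rpow hb0.le hbw hη.le).trans
      (rpow_const_mul_le (by norm_num) hw0.le hη1.le)
    have h2 : |nullD a u q| ≤ |dt u q| + |dx a u q| := by
      refine (abs_add_le _ _).trans (add_le_add ?_ le_rfl)
      rw [abs_mul]
      exact mul_le_of_le_one_left (abs_nonneg _) hfrac
    have e0 := hu 0
    have e1 := hu a.succ
    change _ * |dt u q| ≤ _ at e0
    change _ * |dx a u q| ≤ _ at e1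
    calc b ^ (1 / 2 + η) * |nullD a u q|
        ≤ b ^ (1 / 2 : ℝ) * (4 * w ^ η) * (|dt u q| + |dx a u q|) := by rw [hbη]; gcongr
      _ = 4 * (b ^ (1 / 2 : ℝ) * w ^ η * |dt u q| + b ^ (1 / 2 : ℝ) * w ^ η * |dx a u q|) := by
          ring
      _ ≤ 16 * M := by linarith
      _ ≤ _ := by linarith

end EuclHyp

theorem mainTheorem7 (χ : ℝ → ℝ) (hχ : EuclHyp.IsCutoff χ) :
    ∃ C : ℝ, 0 < C ∧
      ∀ (aleph : ℝ → ℝ), EuclHyp.IsWeightProfile aleph →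
      ∀ (s₀ s₁ : ℝ), 2 ≤ s₀ → s₀ ≤ s₁ →
      ∀ (U : Set EuclHyp.Spacetime), IsOpen U → EuclHyp.tpRegion χ s₀ s₁ ⊆ U →
      ∀ (u : EuclHyp.Spacetime → ℝ), ContDiffOn ℝ 4 u U →
      ∀ (η : ℝ), 0 < η → η < 1 →
      ∀ (s : ℝ), s ∈ Set.Icc s₀ s₁ →
      ∀ (p : EuclHyp.Spacetime), p ∈ EuclHyp.tpSlice χ s →
      ∀ (α : Fin 3) (a : Fin 2),
        ENNReal.ofReal
          (EuclHyp.bracket ‖p.2‖ ^ (1 / 2 : ℝ) * EuclHyp.weight aleph p.1 ‖p.2‖ ^ η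
              * |EuclHyp.pd α u p|
            + EuclHyp.bracket ‖p.2‖ ^ (1 / 2 + η) * |EuclHyp.nullD a u p|)
          ≤ ENNReal.ofReal (C * (1 - η)⁻¹)
            * EuclHyp.energyTPOrd χ aleph 3 3 η s u ^ (1 / 2 : ℝ) := by
  open EuclHyp in
  -- 24 is the Sobolev constant; 1074 adds 2 for the gradient term to 1072 for the semi-null term.
  refine ⟨1074 * 24, by norm_num, ?_⟩
  intro aleph ha s₀ s₁ hs₀ _ U hU hreg u hu4 η hη hη1 s hs p hp α a
  have hs2 : 2 ≤ s := hs₀.trans hs.1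
  have hsub : tpSlice χ s ⊆ U := (subset_biUnion_of_mem (u := fun s => tpSlice χ s) hs).trans hreg
  have hη' : 0 < 1 - η := by linarith
  have hone : 1 ≤ (1 - η)⁻¹ := one_le_inv₀ hη' |>.2 (by linarith)
  rcases eq_or_ne (energyTPOrd χ aleph 3 3 η s u) ⊤ with hE | hE
  · rw [hE, ENNReal.top_rpow_of_pos (by norm_num), ENNReal.mul_top]
    · exact le_top
    · exact (ENNReal.ofReal_pos.2 (by positivity)).ne'
  obtain ⟨y, hy, hθ, rfl⟩ := exists_polarPoint hp
  have hr1 : 1 ≤ y.1 := by linarith [rhoH_ge hs2]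
  have hLs : ContDiffOn ℝ 3 (boost a u) U :=
    contDiffOn_act hU hu4 (by norm_num) (.inr (.inl a))
  set M := 24 * (energyTPOrd χ aleph 3 3 η s u).toReal ^ (1 / 2 : ℝ) with hMdef
  have hM : 0 ≤ M := by positivity
  have h1 : ∀ r, rhoH s ≤ r → ∀ α, r ^ (1 / 2 : ℝ) * weight aleph (timeFn χ s r) r ^ η *
      |pd α u (polarPoint χ s (r, y.2))| ≤ M := fun r hr α =>
    abs_pd_le (l := []) hχ ha hs2 hη.le hU hsub (by simp) (hu4.of_le (by norm_num)) hE
      (y := (r, y.2)) hr hθ α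
  have h2 : ∀ r, rhoH s ≤ r → ∀ α, r ^ (1 / 2 : ℝ) * weight aleph (timeFn χ s r) r ^ η *
      |pd α (boost a u) (polarPoint χ s (r, y.2))| ≤ M := fun r hr α =>
    abs_pd_le (l := [.inr (.inl a)]) hχ ha hs2 hη.le hU hsub (by simp) hLs hE
      (y := (r, y.2)) hr hθ α
  have hw := three_le_weight hχ ha hs2 hy
  have h3 : ∀ α, bracket y.1 ^ (1 / 2 : ℝ) * weight aleph (timeFn χ s y.1) y.1 ^ η *
      |pd α u (polarPoint χ s y)| ≤ 2 * M := fun α => by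
    have hb := bracket_rpow_half_le hr1
    calc _ ≤ 2 * y.1 ^ (1 / 2 : ℝ) * weight aleph (timeFn χ s y.1) y.1 ^ η *
          |pd α u (polarPoint χ s y)| := by gcongr
      _ = 2 * (y.1 ^ (1 / 2 : ℝ) * weight aleph (timeFn χ s y.1) y.1 ^ η *
          |pd α u (polarPoint χ s y)|) := by ring
      _ ≤ 2 * M := by linarith [h1 y.1 hy α]
  have h4 := bracket_mul_nullD_le hχ ha hs2 hη hη1 hM a hy h3 fun hc =>
    abs_boost_le hχ ha hs2 hη hη1 hM hU hsub a (hLs.of_le (by norm_num)) h1 h2 ⟨hy, hc⟩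
  have hMM : M ≤ M * (1 - η)⁻¹ := le_mul_of_one_le_right hM hone
  have hn : ‖(polarPoint χ s y).2‖ = y.1 :=
    (norm_polarPoint χ s y).trans (abs_of_nonneg (by linarith))
  have hq1 : (polarPoint χ s y).1 = timeFn χ s y.1 := rfl
  rw [hn, hq1, ← ENNReal.ofReal_toReal hE, ENNReal.ofReal_rpow_of_nonneg ENNReal.toReal_nonneg
    (by norm_num), ← ENNReal.ofReal_mul (by positivity)]
  refine ENNReal.ofReal_le_ofReal ((add_le_add (h3 α) h4).trans ?_)
  calc 2 * M + 1072 * M * (1 - η)⁻¹ ≤ 1074 * (M * (1 - η)⁻¹) := by linarith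
    _ = _ := by rw [hMdef]; ring
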